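/- Let $d\ge 2$ and let $\psi:\mathbb{R}\to\mathbb{R}$ be a Schwartz function supported in $[1/2,2]$. For $t\in\mathbb{R}$ and $x\in\mathbb{R}^d$ put $$I(x,t)=\int_{\mathbb{R}^d}\psi(|\xi|)\,e^{i[t\xi_1|\xi|+x\cdot\xi]}\,d\xi ,$$ where $\xi_1$ is the first coordinate of $\xi$, and let $\alpha=1$ if $d\ge 3$ and $\alpha=5/6$ if $d=2$. Then there is a constant $C$, depending only on $d$ and $\psi$, such that $$|I(x,t)|\le C|t|^{-\alpha}\qquad\text{for all } t\neq 0 \text{ and all } x\in\mathbb{R}^d .$$ This rate of decay is optimal: if $\psi$ is not identically zero, then there are constants $c,T>0$, depending only on $d$ and $\psi$, such that for every real $t$ with $|t|\ge T$ there is a point $x\in\mathbb{R}^d$ with $|I(x,t)|\ge c|t|^{-\alpha}$. -/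

import Mathlib

noncomputable section

/-- The oscillatory integral `∫ ψ(|ξ|) e^{i (t ξ₁ |ξ| + x · ξ)} dξ` over `ℝ^d` (`d ≥ 1`) with
Lebesgue measure; `ξ₁` is the first coordinate of `ξ` and `|ξ|` its Euclidean norm. -/
def oscIntegral {d : ℕ} (hd : 0 < d) (ψ : ℝ → ℝ) (t : ℝ) (x : EuclideanSpace ℝ (Fin d)) : ℂ :=
  ∫ ξ : EuclideanSpace ℝ (Fin d),
    (ψ ‖ξ‖ : ℂ) * Complex.exp (Complex.I * ((t * ξ ⟨0, hd⟩ * ‖ξ‖ + inner ℝ x ξ : ℝ) : ℂ))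

/-- `sup_x |I(x,t)| ≤ C |t|^{-α}` for all `t ≠ 0`, with `C` independent of `t` and `x`. -/
def DecaysAtRate {d : ℕ} (hd : 0 < d) (ψ : ℝ → ℝ) (α : ℝ) : Prop :=
  ∃ C : ℝ, ∀ t : ℝ, t ≠ 0 → ∀ x : EuclideanSpace ℝ (Fin d),
    ‖oscIntegral hd ψ t x‖ ≤ C * |t| ^ (-α)

/-- Matching lower bound: for every large `|t|`, the bound `|t|^{-α}` is attained, up to a
constant factor independent of `t`, at some point `x`. -/
def RateIsOptimal {d : ℕ} (hd : 0 < d) (ψ : ℝ → ℝ) (α : ℝ) : Prop :=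
  ∃ c T : ℝ, 0 < c ∧ 0 < T ∧ ∀ t : ℝ, T ≤ |t| → ∃ x : EuclideanSpace ℝ (Fin d),
    c * |t| ^ (-α) ≤ ‖oscIntegral hd ψ t x‖

end

/-! Upper bound. The phase equals (t|ξ|e₁ + x)·ξ, so on the sphere |ξ| = r the exponential is a
plane wave with frequency vector t r e₁ + x. By rotation invariance only the length of that vector
matters. For t > 0 this length is t D(r), where D(r) is the distance in the plane from (r, 0) to a
"focus" (s, b), with s = -x₁/t and b = |x'|/t (x' is x without its first coordinate). With d = n +
2, I(x,t) becomes a constant times ∫ r^(n+1) ψ(r) Φ(t r D(r)) dr, where Φ = `sphereTransform n`. The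
task is then a one-dimensional estimate, uniform in s and b (`oscIntegral_eq_radial_integral`).

Write Φ(ρ) = 2 Re(A(ρ) e^{iρ}) with A = `sphereAmplitude n`. Here A is bounded and O(ρ^{-1/2}), its
derivative is O((1+ρ)^{-3/2}), and A is also O(1/ρ) if n ≥ 1. Let p(r) = r D(r). Where p' is bounded
away from 0, one integration by parts gives 1/t, since the variation of A(t p(r)) and of p' is
bounded uniformly. Near a focus close to the axis, D is comparable to b and p'' to 1/b, so van der
Corput gives (b/t)^{1/2} against an amplitude (tb)^{-1/2}, again 1/t
(`norm_radial_integral_le_add`). What remains lies to the left of the focus, with D bounded below.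
There A = O(1/t) trivially if d ≥ 3. If d = 2, the amplitude gives t^{-1/2} and the oscillation
t^{-1/3}, because p' and p'' may vanish together while p''' stays positive; the product is t^{-5/6}.

Lower bound. A bump function is a superposition of plane waves with integrable coefficients, and
multiplication by a plane wave only translates x. So a bound for |I(x,t)| over all x also bounds the
integral of the same integrand against any affine copy of the bump. If the phase is within 1 of an
affine function on a box where ψ(|ξ|) has one sign, that integral is at least a multiple of the
volume of the box (`exists_le_norm_oscIntegral`). For d ≥ 3 the box is a slab of width 1/t around ξ₁
= 0. For d = 2 it is a t^{-1/2} × t^{-1/3} box at a point where the Hessian of ξ₁|ξ| degenerates,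
the long side lying along the kernel. -/

section

open MeasureTheory Set intervalIntegral

/-! ### Van der Corput estimates with explicit constants -/

/-- Integration by parts against a phase without stationary points. -/
theorem norm_integral_mul_exp_le {p p' p'' : ℝ → ℝ} {f f' : ℝ → ℂ} {a b : ℝ} (hab : a ≤ b)
    (hp : ∀ x, HasDerivAt p (p' x) x) (hp' : ∀ x, HasDerivAt p' (p'' x) x)
    (hp'' : Continuous p'') (hf : ∀ x, HasDerivAt f (f' x) x) (hf' : Continuous f')
    (h0 : ∀ x ∈ Icc a b, p' x ≠ 0) :
    ‖∫ x in a..b, f x * Complex.exp (Complex.I * p x)‖ ≤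
      ‖f b‖ / |p' b| + ‖f a‖ / |p' a| +
        ∫ x in a..b, (‖f' x‖ / |p' x| + ‖f x‖ * |p'' x| / p' x ^ 2) := by
  have cp : Continuous p := continuous_iff_continuousAt.2 fun x => (hp x).continuousAt
  have cp' : Continuous p' := continuous_iff_continuousAt.2 fun x => (hp' x).continuousAt
  have cf : Continuous f := continuous_iff_continuousAt.2 fun x => (hf x).continuousAt
  set E : ℝ → ℂ := fun x => Complex.exp (Complex.I * p x) with hE
  have hnE : ∀ x, ‖E x‖ = 1 := fun x => by
    rw [hE]; dsimp only; rw [mul_comm]; exact Complex.norm_exp_ofReal_mul_I _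
  have cE : Continuous E := by fun_prop
  have hdE : ∀ x, HasDerivAt E (Complex.I * p' x * E x) x := fun x => by
    have := (((hp x).ofReal_comp).const_mul Complex.I).cexp
    convert! this using 1
    simp only [hE]; ring
  set R : ℝ → ℂ := fun x => (f' x / p' x - f x * p'' x / (p' x : ℂ) ^ 2) / Complex.I * E x with hR
  have hne : ∀ x ∈ Icc a b, (p' x : ℂ) ≠ 0 := fun x hx => by exact_mod_cast h0 x hx
  have hD : ∀ x ∈ uIcc a b, HasDerivAt (fun x => f x / p' x / Complex.I * E x)
      (f x * E x + R x) x := fun x hx => by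
    rw [uIcc_of_le hab] at hx
    have h1 := ((((hf x).div ((hp' x).ofReal_comp) (hne x hx)).div_const Complex.I).mul (hdE x))
    convert! h1 using 1
    have := hne x hx
    simp only [hR, Pi.div_apply]
    field_simp [Complex.I_ne_zero]
    ring
  have cR : ContinuousOn R (Icc a b) := by
    refine ContinuousOn.mul (ContinuousOn.div_const (ContinuousOn.sub
      (ContinuousOn.div (by fun_prop) (by fun_prop) hne)
      (ContinuousOn.div (by fun_prop) (by fun_prop) fun x hx => pow_ne_zero _ (hne x hx))) _)
      cE.continuousOn
  have iR : IntervalIntegrable R volume a b :=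
    ContinuousOn.intervalIntegrable (by rwa [uIcc_of_le hab])
  have iF : IntervalIntegrable (fun x => f x * E x) volume a b :=
    (cf.mul cE).intervalIntegrable _ _
  have key := integral_eq_sub_of_hasDerivAt hD (iF.add iR)
  rw [integral_add iF iR] at key
  have h2 : (∫ x in a..b, f x * E x) =
      f b / p' b / Complex.I * E b - f a / p' a / Complex.I * E a - ∫ x in a..b, R x := by
    rw [← key]; ring
  rw [h2]
  have nb : ∀ x, ‖f x / p' x / Complex.I * E x‖ = ‖f x‖ / |p' x| := fun x => by
    simp [hnE]
  have c1 : ContinuousOn (fun x => ‖f' x‖ / |p' x| + ‖f x‖ * |p'' x| / p' x ^ 2) (Icc a b) :=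
    ContinuousOn.add (ContinuousOn.div (by fun_prop) (by fun_prop)
        fun x hx => abs_ne_zero.2 (h0 x hx))
      (ContinuousOn.div (by fun_prop) (by fun_prop) fun x hx => pow_ne_zero _ (h0 x hx))
  have h3 : ‖∫ x in a..b, R x‖ ≤
      ∫ x in a..b, (‖f' x‖ / |p' x| + ‖f x‖ * |p'' x| / p' x ^ 2) := by
    refine norm_integral_le_of_norm_le hab (Filter.Eventually.of_forall fun x _ => ?_)
      (ContinuousOn.intervalIntegrable (by rwa [uIcc_of_le hab]))
    simp only [hR, norm_mul, norm_div, hnE, Complex.norm_I, div_one, mul_one]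
    refine (norm_sub_le _ _).trans (le_of_eq ?_)
    simp
  refine (norm_sub_le _ _).trans (add_le_add ((norm_sub_le _ _).trans ?_) h3)
  rw [nb, nb]

/-- Van der Corput's lemma for a phase with monotone derivative bounded away from zero. -/
theorem vanDerCorput_one {p p' p'' : ℝ → ℝ} {a b l : ℝ} (hab : a ≤ b) (hl : 0 < l)
    (hp : ∀ x, HasDerivAt p (p' x) x) (hp' : ∀ x, HasDerivAt p' (p'' x) x)
    (hp'' : Continuous p'') (h1 : ∀ x ∈ Icc a b, l ≤ |p' x|) (h2 : ∀ x ∈ Icc a b, 0 ≤ p'' x) :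
    ‖∫ x in a..b, Complex.exp (Complex.I * p x)‖ ≤ 4 / l := by
  have h0 : ∀ x ∈ Icc a b, p' x ≠ 0 := fun x hx => abs_pos.1 (hl.trans_le (h1 x hx))
  have cp' : Continuous p' := continuous_iff_continuousAt.2 fun x => (hp' x).continuousAt
  have := norm_integral_mul_exp_le (f := fun _ => 1) (f' := fun _ => 0) hab hp hp' hp''
    (fun x => hasDerivAt_const x _) continuous_const h0
  simp only [one_mul, norm_one, norm_zero, zero_div, zero_add] at this
  refine this.trans ?_
  -- As p'' ≥ 0, the integrand is the exact derivative of -1/p', so no length of the interval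
  -- enters.
  have e : (∫ x in a..b, |p'' x| / p' x ^ 2) = (p' a)⁻¹ - (p' b)⁻¹ := by
    have h := integral_eq_sub_of_hasDerivAt (a := a) (b := b) (f := fun x => -(p' x)⁻¹)
      (f' := fun x => |p'' x| / p' x ^ 2) ?_ ?_
    · rw [h]; ring
    · intro x hx
      rw [uIcc_of_le hab] at hx
      convert! ((hp' x).inv (h0 x hx)).neg using 1
      rw [abs_of_nonneg (h2 x hx)]; ring
    · refine ContinuousOn.intervalIntegrable ?_
      rw [uIcc_of_le hab]
      exact ContinuousOn.div (by fun_prop) (by fun_prop) fun x hx => pow_ne_zero _ (h0 x hx)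
  rw [e]
  have k : ∀ x ∈ Icc a b, 1 / |p' x| ≤ 1 / l := fun x hx => by gcongr; exact h1 x hx
  have ka := k a (left_mem_Icc.2 hab)
  have kb := k b (right_mem_Icc.2 hab)
  have k2 : (p' a)⁻¹ - (p' b)⁻¹ ≤ 1 / |p' a| + 1 / |p' b| := by
    rw [one_div, one_div, ← abs_inv, ← abs_inv]
    linarith [le_abs_self (p' a)⁻¹, neg_abs_le (p' b)⁻¹]
  have : 4 / l = 4 * (1 / l) := by ring
  rw [this]; linarith

/-- Since q grows at rate at least m, it moves away linearly from its zero c; when q has no sign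
change, c is the endpoint where |q| is smallest. This locates the window to excise in the higher van
der Corput estimates. -/
theorem exists_linear_growth_of_deriv_ge {q q' : ℝ → ℝ} {a b m : ℝ} (hab : a ≤ b)
    (hq : ∀ x, HasDerivAt q (q' x) x) (h : ∀ x ∈ Icc a b, m ≤ q' x) :
    ∃ c ∈ Icc a b, (∀ x ∈ Icc a b, c < x → m * (x - c) ≤ q x) ∧
      ∀ x ∈ Icc a b, x < c → q x ≤ -(m * (c - x)) := by
  have cq : Continuous q := continuous_iff_continuousAt.2 fun x => (hq x).continuousAt
  have inc : ∀ x ∈ Icc a b, ∀ y ∈ Icc a b, x ≤ y → m * (y - x) ≤ q y - q x := by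
    refine (convex_Icc a b).mul_sub_le_image_sub_of_le_deriv cq.continuousOn
      (fun x _ => (hq x).differentiableAt.differentiableWithinAt) fun x hx => ?_
    rw [(hq x).deriv]
    exact h x (interior_subset hx)
  have ma := left_mem_Icc.2 hab
  have mb := right_mem_Icc.2 hab
  rcases le_or_gt 0 (q a) with ha | ha
  · exact ⟨a, ma, fun x hx _ => by linarith [inc a ma x hx hx.1],
      fun x hx hxa => absurd hx.1 (not_le.2 hxa)⟩
  rcases le_or_gt (q b) 0 with hb | hb
  · exact ⟨b, mb, fun x hx hxa => absurd hx.2 (not_le.2 hxa),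
      fun x hx _ => by linarith [inc x hx b mb hx.2]⟩
  obtain ⟨c, hc, h0⟩ := intermediate_value_Icc hab cq.continuousOn ⟨ha.le, hb.le⟩
  exact ⟨c, hc, fun x hx hxc => by linarith [inc c hc x hx hxc.le],
    fun x hx hxc => by linarith [inc x hx c hc hxc.le]⟩

/-- The window of radius η about c costs at most its length 2η because the integrand has size at
most 1. The two outer pieces, when nonempty, cost B each. -/
theorem norm_integral_le_of_split {E : ℝ → ℂ} (cE : Continuous E) (nE : ∀ x, ‖E x‖ ≤ 1)
    {a b c η B : ℝ} (hc : c ∈ Icc a b) (hη : 0 ≤ η) (hB : 0 ≤ B)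
    (h1 : a ≤ c - η → ‖∫ x in a..(c - η), E x‖ ≤ B)
    (h2 : c + η ≤ b → ‖∫ x in (c + η)..b, E x‖ ≤ B) :
    ‖∫ x in a..b, E x‖ ≤ 2 * η + 2 * B := by
  have iE : ∀ x y, IntervalIntegrable E volume x y := fun x y => cE.intervalIntegrable _ _
  rw [← integral_add_adjacent_intervals (iE a (max a (c - η))) (iE _ b),
    ← integral_add_adjacent_intervals (iE (max a (c - η)) (min b (c + η))) (iE _ b)]
  have k1 : ‖∫ x in a..(max a (c - η)), E x‖ ≤ B := by
    rcases le_total a (c - η) with h | h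
    · rw [max_eq_right h]; exact h1 h
    · rw [max_eq_left h]; simpa using hB
  have k2 : ‖∫ x in (min b (c + η))..b, E x‖ ≤ B := by
    rcases le_total b (c + η) with h | h
    · rw [min_eq_left h]; simpa using hB
    · rw [min_eq_right h]; exact h2 h
  have k3 : ‖∫ x in (max a (c - η))..(min b (c + η)), E x‖ ≤ 2 * η := by
    have := norm_integral_le_of_norm_le_const (a := max a (c - η)) (b := min b (c + η))
      (f := E) (C := 1) fun x _ => nE x
    refine this.trans ?_
    have l1 : max a (c - η) ≤ min b (c + η) :=
      max_le (le_min (hc.1.trans hc.2) (by linarith [hc.1])) (le_min (by linarith [hc.2])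
        (by linarith))
    rw [abs_of_nonneg (sub_nonneg.2 l1), one_mul]
    linarith [min_le_right b (c + η), le_max_right a (c - η)]
  linarith [norm_add_le (∫ x in a..(max a (c - η)), E x) ((∫ x in (max a (c - η))..(min b (c + η)),
    E x) + ∫ x in (min b (c + η))..b, E x), norm_add_le (∫ x in (max a (c - η))..(min b (c + η)),
    E x) (∫ x in (min b (c + η))..b, E x)]

theorem norm_exp_I_mul (x : ℝ) : ‖Complex.exp (Complex.I * x)‖ = 1 := by
  rw [mul_comm]; exact Complex.norm_exp_ofReal_mul_I _

/-- Van der Corput's lemma of order two, with a free splitting parameter `η`. -/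
theorem vanDerCorput_two {p p' p'' : ℝ → ℝ} {a b m η : ℝ} (hab : a ≤ b) (hm : 0 < m) (hη : 0 < η)
    (hp : ∀ x, HasDerivAt p (p' x) x) (hp' : ∀ x, HasDerivAt p' (p'' x) x)
    (hp'' : Continuous p'') (h2 : ∀ x ∈ Icc a b, m ≤ p'' x) :
    ‖∫ x in a..b, Complex.exp (Complex.I * p x)‖ ≤ 2 * η + 8 / (m * η) := by
  have cp : Continuous p := continuous_iff_continuousAt.2 fun x => (hp x).continuousAt
  obtain ⟨c, hc, g1, g2⟩ := exists_linear_growth_of_deriv_ge hab hp' h2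
  have := norm_integral_le_of_split (E := fun x => Complex.exp (Complex.I * p x)) (by fun_prop)
    (fun x => (norm_exp_I_mul _).le) hc hη.le (B := 4 / (m * η)) (by positivity)
    (fun h => vanDerCorput_one h (by positivity) hp hp' hp'' (fun x hx => ?_)
      fun x hx => hm.le.trans (h2 x ⟨hx.1, by linarith [hx.2, hc.2]⟩))
    (fun h => vanDerCorput_one h (by positivity) hp hp' hp'' (fun x hx => ?_)
      fun x hx => hm.le.trans (h2 x ⟨by linarith [hx.1, hc.1], hx.2⟩))
  · refine this.trans (le_of_eq ?_); ring
  · have := g2 x ⟨hx.1, by linarith [hx.2, hc.2]⟩ (by linarith [hx.2])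
    refine le_trans ?_ (neg_le_abs _)
    nlinarith [hx.2]
  · have := g1 x ⟨by linarith [hx.1, hc.1], hx.2⟩ (by linarith [hx.1])
    refine le_trans ?_ (le_abs_self _)
    nlinarith [hx.1]

theorem norm_integral_exp_neg (p : ℝ → ℝ) (a b : ℝ) :
    ‖∫ x in a..b, Complex.exp (Complex.I * (-p x : ℝ))‖ =
      ‖∫ x in a..b, Complex.exp (Complex.I * p x)‖ := by
  have : ∀ x, Complex.exp (Complex.I * (-p x : ℝ)) =
      (starRingEnd ℂ) (Complex.exp (Complex.I * p x)) := fun x => by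
    rw [← Complex.exp_conj]; simp
  simp_rw [this]
  rw [intervalIntegral_conj, RCLike.norm_conj]

theorem vanDerCorput_two_neg {p p' p'' : ℝ → ℝ} {a b m η : ℝ} (hab : a ≤ b) (hm : 0 < m)
    (hη : 0 < η) (hp : ∀ x, HasDerivAt p (p' x) x) (hp' : ∀ x, HasDerivAt p' (p'' x) x)
    (hp'' : Continuous p'') (h2 : ∀ x ∈ Icc a b, p'' x ≤ -m) :
    ‖∫ x in a..b, Complex.exp (Complex.I * p x)‖ ≤ 2 * η + 8 / (m * η) := by
  rw [← norm_integral_exp_neg]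
  exact vanDerCorput_two hab hm hη (fun x => (hp x).neg) (fun x => (hp' x).neg) hp''.neg
    fun x hx => by linarith [h2 x hx]

/-- Van der Corput's lemma of order three, with free splitting parameters. -/
theorem vanDerCorput_three {p p' p'' p''' : ℝ → ℝ} {a b m η κ : ℝ} (hab : a ≤ b) (hm : 0 < m)
    (hη : 0 < η) (hκ : 0 < κ) (hp : ∀ x, HasDerivAt p (p' x) x)
    (hp' : ∀ x, HasDerivAt p' (p'' x) x) (hp'' : ∀ x, HasDerivAt p'' (p''' x) x)
    (h3 : ∀ x ∈ Icc a b, m ≤ p''' x) :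
    ‖∫ x in a..b, Complex.exp (Complex.I * p x)‖ ≤ 2 * κ + 2 * (2 * η + 8 / (m * κ * η)) := by
  have cp : Continuous p := continuous_iff_continuousAt.2 fun x => (hp x).continuousAt
  have cp'' : Continuous p'' := continuous_iff_continuousAt.2 fun x => (hp'' x).continuousAt
  obtain ⟨c, hc, g1, g2⟩ := exists_linear_growth_of_deriv_ge hab hp'' h3
  refine norm_integral_le_of_split (E := fun x => Complex.exp (Complex.I * p x)) (by fun_prop)
    (fun x => (norm_exp_I_mul _).le) hc hκ.le (by positivity)
    (fun h => vanDerCorput_two_neg h (by positivity) hη hp hp' cp'' fun x hx => ?_)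
    (fun h => vanDerCorput_two h (by positivity) hη hp hp' cp'' fun x hx => ?_)
  · have := g2 x ⟨hx.1, by linarith [hx.2, hc.2]⟩ (by linarith [hx.2])
    nlinarith [hx.2]
  · have := g1 x ⟨by linarith [hx.1, hc.1], hx.2⟩ (by linarith [hx.1])
    nlinarith [hx.1]

/-- An amplitude costs its size at the endpoint plus its total variation. -/
theorem norm_integral_mul_le_of_primitive_le {f f' E : ℝ → ℂ} {a b M : ℝ} (hab : a ≤ b)
    (hf : ∀ x, HasDerivAt f (f' x) x) (hf' : Continuous f') (cE : Continuous E)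
    (hM : ∀ x ∈ Icc a b, ‖∫ y in a..x, E y‖ ≤ M) :
    ‖∫ x in a..b, f x * E x‖ ≤ M * (‖f b‖ + ∫ x in a..b, ‖f' x‖) := by
  have hd : ∀ x, HasDerivAt (fun x => ∫ y in a..x, E y) (E x) x := fun x =>
    integral_hasDerivAt_right (cE.intervalIntegrable _ _)
      (cE.stronglyMeasurableAtFilter _ _) cE.continuousAt
  have cG : Continuous fun x => ∫ y in a..x, E y :=
    continuous_iff_continuousAt.2 fun x => (hd x).continuousAt
  rw [integral_mul_deriv_eq_deriv_mul (u := f) (v := fun x => ∫ y in a..x, E y) (u' := f')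
    (fun x _ => hf x) (fun x _ => hd x) (hf'.intervalIntegrable _ _) (cE.intervalIntegrable _ _)]
  rw [integral_same, mul_zero, sub_zero, mul_add]
  refine (norm_sub_le _ _).trans (add_le_add ?_ ?_)
  · rw [norm_mul, mul_comm]
    exact mul_le_mul_of_nonneg_right (hM b (right_mem_Icc.2 hab)) (norm_nonneg _)
  · rw [← intervalIntegral.integral_const_mul]
    refine norm_integral_le_of_norm_le hab (Filter.Eventually.of_forall fun x hx => ?_)
      ((by fun_prop : Continuous fun x => M * ‖f' x‖).intervalIntegrable _ _)
    rw [norm_mul, mul_comm]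
    exact mul_le_mul_of_nonneg_right (hM x ⟨hx.1.le, hx.2⟩) (norm_nonneg _)

/-! ### The radial phase and its derivatives -/

/-- The distance from `(r, 0)` to `(s, b)` in the plane. -/
noncomputable def planarDist (s b r : ℝ) : ℝ := √((r - s) ^ 2 + b ^ 2)

/-- The radial phase `r ↦ r |(r, 0) - (s, b)|`. -/
noncomputable def radialPhase (s b r : ℝ) : ℝ := r * planarDist s b r

noncomputable def radialPhase₁ (s b r : ℝ) : ℝ :=
  planarDist s b r + r * ((r - s) / planarDist s b r)

noncomputable def radialPhase₂ (s b r : ℝ) : ℝ :=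
  2 * ((r - s) / planarDist s b r) + r * (b ^ 2 / planarDist s b r ^ 3)

/-- For 0 ≤ r ≤ s the bracket is D² + r(s - r) ≥ D², so the third derivative is at least 3b²/D³.
This is what prevents a degeneracy of higher order. -/
noncomputable def radialPhase₃ (s b r : ℝ) : ℝ :=
  3 * b ^ 2 * (planarDist s b r ^ 2 - r * (r - s)) / planarDist s b r ^ 5

section phase
variable {s b : ℝ}

theorem planarDist_sq (s b r : ℝ) : planarDist s b r ^ 2 = (r - s) ^ 2 + b ^ 2 :=
  Real.sq_sqrt (by positivity)

theorem planarDist_pos (hb : 0 < b) (r : ℝ) : 0 < planarDist s b r :=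
  Real.sqrt_pos.2 (by positivity)

theorem abs_sub_le_planarDist (s b r : ℝ) : |r - s| ≤ planarDist s b r :=
  Real.abs_le_sqrt (by nlinarith [sq_nonneg b])

theorem le_planarDist (s b r : ℝ) : b ≤ planarDist s b r :=
  Real.le_sqrt_of_sq_le (by nlinarith [sq_nonneg (r - s)])

theorem abs_sub_div_planarDist_le (hb : 0 < b) (r : ℝ) : |(r - s) / planarDist s b r| ≤ 1 := by
  rw [abs_div, abs_of_pos (planarDist_pos hb r)]
  exact div_le_one_of_le₀ (abs_sub_le_planarDist _ _ _) (planarDist_pos hb r).le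

theorem planarDist_le_add (s b r r' : ℝ) : planarDist s b r ≤ planarDist s b r' + |r - r'| := by
  have h0 : 0 ≤ planarDist s b r' := Real.sqrt_nonneg _
  refine Real.sqrt_le_iff.2 ⟨by positivity, ?_⟩
  have h1 := planarDist_sq s b r'
  have h2 := abs_sub_le_planarDist s b r'
  have h3 : (r' - s) * (r - r') ≤ planarDist s b r' * |r - r'| := by
    refine (le_abs_self _).trans ?_
    rw [abs_mul]
    exact mul_le_mul_of_nonneg_right h2 (abs_nonneg _)
  have h4 : |r - r'| ^ 2 = (r - r') ^ 2 := sq_abs _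
  nlinarith

theorem hasDerivAt_planarDist (hb : 0 < b) (r : ℝ) :
    HasDerivAt (planarDist s b) ((r - s) / planarDist s b r) r := by
  have h : HasDerivAt (fun r : ℝ => (r - s) ^ 2 + b ^ 2) (2 * (r - s)) r := by
    convert! (((hasDerivAt_id r).sub_const s).pow 2).add_const (b ^ 2) using 1
    simp
  convert! h.sqrt (by positivity) using 1
  unfold planarDist
  rw [mul_div_mul_left _ _ two_ne_zero]

theorem hasDerivAt_sub_div_planarDist (hb : 0 < b) (r : ℝ) :
    HasDerivAt (fun r => (r - s) / planarDist s b r) (b ^ 2 / planarDist s b r ^ 3) r := by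
  have h0 := (planarDist_pos (s := s) hb r).ne'
  convert! ((hasDerivAt_id r).sub_const s).div (hasDerivAt_planarDist hb r) h0 using 1
  have := planarDist_sq s b r
  simp only [id]
  field_simp
  linarith

theorem hasDerivAt_sq_div_planarDist (hb : 0 < b) (r : ℝ) :
    HasDerivAt (fun r => b ^ 2 / planarDist s b r ^ 3)
      (-3 * b ^ 2 * (r - s) / planarDist s b r ^ 5) r := by
  have h0 := (planarDist_pos (s := s) hb r).ne'
  convert! (hasDerivAt_const r (b ^ 2)).div ((hasDerivAt_planarDist hb r).pow 3)
    (pow_ne_zero 3 h0) using 1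
  simp only [Pi.pow_apply]
  field_simp
  ring

theorem hasDerivAt_radialPhase (hb : 0 < b) (r : ℝ) :
    HasDerivAt (radialPhase s b) (radialPhase₁ s b r) r := by
  convert! (hasDerivAt_id r).mul (hasDerivAt_planarDist hb r) using 1
  simp [radialPhase₁]

theorem hasDerivAt_radialPhase₁ (hb : 0 < b) (r : ℝ) :
    HasDerivAt (radialPhase₁ s b) (radialPhase₂ s b r) r := by
  convert! (hasDerivAt_planarDist hb r).add
    ((hasDerivAt_id r).mul (hasDerivAt_sub_div_planarDist hb r)) using 1
  simp only [radialPhase₂, id]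
  ring

theorem hasDerivAt_radialPhase₂ (hb : 0 < b) (r : ℝ) :
    HasDerivAt (radialPhase₂ s b) (radialPhase₃ s b r) r := by
  have h0 := (planarDist_pos (s := s) hb r).ne'
  convert! ((hasDerivAt_sub_div_planarDist hb r).const_mul 2).add
    ((hasDerivAt_id r).mul (hasDerivAt_sq_div_planarDist hb r)) using 1
  simp only [radialPhase₃, id]
  field_simp
  ring

theorem continuous_radialPhase₂ (hb : 0 < b) : Continuous (radialPhase₂ s b) :=
  continuous_iff_continuousAt.2 fun x => (hasDerivAt_radialPhase₂ hb x).continuousAt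

theorem continuous_radialPhase₁ (hb : 0 < b) : Continuous (radialPhase₁ s b) :=
  continuous_iff_continuousAt.2 fun x => (hasDerivAt_radialPhase₁ hb x).continuousAt

theorem continuous_radialPhase (s b : ℝ) : Continuous (radialPhase s b) := by
  unfold radialPhase planarDist; fun_prop

theorem abs_radialPhase₁_le (hb : 0 < b) {r : ℝ} (h1 : 0 ≤ r) (h2 : r ≤ 2) :
    |radialPhase₁ s b r| ≤ planarDist s b r + 2 := by
  refine (abs_add_le _ _).trans (add_le_add (abs_of_pos (planarDist_pos hb r)).le ?_)
  rw [abs_mul, abs_of_nonneg h1]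
  nlinarith [abs_sub_div_planarDist_le (s := s) hb r, abs_nonneg ((r - s) / planarDist s b r)]

/-- The term 2(r - s)/D has size at most 2 on a length at most 3/2. In the other term r ≤ 2
multiplies the exact derivative of (r - s)/D, which takes values in [-1, 1]. The bound 3 + 4 is
uniform as b → 0, although the second derivative peaks like 1/b. -/
theorem integral_abs_radialPhase₂_le (hb : 0 < b) {α β : ℝ} (hα : 1 / 2 ≤ α) (hαβ : α ≤ β)
    (hβ : β ≤ 2) : ∫ r in α..β, |radialPhase₂ s b r| ≤ 7 := by
  have c1 : Continuous fun r => b ^ 2 / planarDist s b r ^ 3 :=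
    continuous_iff_continuousAt.2 fun x => (hasDerivAt_sq_div_planarDist hb x).continuousAt
  have h1 : ∫ r in α..β, |radialPhase₂ s b r| ≤
      ∫ r in α..β, (2 + 2 * (b ^ 2 / planarDist s b r ^ 3)) := by
    refine integral_mono_on hαβ ((continuous_radialPhase₂ hb).abs.intervalIntegrable _ _)
      ((by fun_prop : Continuous _).intervalIntegrable _ _) fun r hr => ?_
    have h0 := planarDist_pos (s := s) hb r
    have h2 : 0 ≤ b ^ 2 / planarDist s b r ^ 3 := by positivity
    refine (abs_add_le _ _).trans (add_le_add ?_ ?_)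
    · rw [abs_mul, abs_two]
      linarith [abs_sub_div_planarDist_le (s := s) hb r]
    · rw [abs_of_nonneg (mul_nonneg (by linarith [hr.1]) h2)]
      exact mul_le_mul_of_nonneg_right (hr.2.trans hβ) h2
  refine h1.trans ?_
  rw [integral_add (by simp) ((by fun_prop : Continuous _).intervalIntegrable _ _),
    intervalIntegral.integral_const_mul,
    integral_eq_sub_of_hasDerivAt (fun x _ => hasDerivAt_sub_div_planarDist (s := s) hb x)
      (c1.intervalIntegrable _ _), intervalIntegral.integral_const, smul_eq_mul]
  have e1 := abs_le.1 (abs_sub_div_planarDist_le (s := s) hb α)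
  have e2 := abs_le.1 (abs_sub_div_planarDist_le (s := s) hb β)
  linarith [e1.1, e2.2]

end phase

/-! ### Amplitudes evaluated along the radial phase -/

/-- The size and derivative bounds satisfied by the amplitude of the Fourier transform of the
circle. -/
structure IsBesselAmplitude (K : ℝ) (A A' : ℝ → ℂ) : Prop where
  hasDerivAt : ∀ ρ, HasDerivAt A (A' ρ) ρ
  continuous_deriv : Continuous A'
  norm_le : ∀ ρ, 0 ≤ ρ → ‖A ρ‖ ≤ K
  norm_le_sqrt : ∀ ρ, 0 < ρ → ‖A ρ‖ ≤ K / √ρ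
  norm_deriv_le : ∀ ρ, 0 ≤ ρ → ‖A' ρ‖ ≤ K / ((1 + ρ) * √(1 + ρ))

/-- A `C¹` weight bounded by `W` together with its derivative on `[1/2, 2]`. -/
structure IsWeight (W : ℝ) (w w' : ℝ → ℂ) : Prop where
  hasDerivAt : ∀ r, HasDerivAt w (w' r) r
  continuous_deriv : Continuous w'
  norm_le : ∀ r ∈ Icc (1 / 2 : ℝ) 2, ‖w r‖ ≤ W
  norm_deriv_le : ∀ r ∈ Icc (1 / 2 : ℝ) 2, ‖w' r‖ ≤ W

section amplitude
variable {K W : ℝ} {A A' w w' : ℝ → ℂ} {s b t : ℝ}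

theorem hasDerivAt_amplitude (hA : IsBesselAmplitude K A A') (hw : IsWeight W w w') (hb : 0 < b)
    (t r : ℝ) :
    HasDerivAt (fun r => w r * A (t * radialPhase s b r))
      (w' r * A (t * radialPhase s b r) +
        w r * ((t * radialPhase₁ s b r : ℝ) * A' (t * radialPhase s b r))) r := by
  have h := (hA.hasDerivAt (t * radialPhase s b r)).scomp r
    ((hasDerivAt_radialPhase (s := s) hb r).const_mul t)
  exact (hw.hasDerivAt r).mul h

theorem IsBesselAmplitude.continuous (hA : IsBesselAmplitude K A A') : Continuous A :=
  continuous_iff_continuousAt.2 fun x => (hA.hasDerivAt x).continuousAt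

theorem IsWeight.continuous (hw : IsWeight W w w') : Continuous w :=
  continuous_iff_continuousAt.2 fun x => (hw.hasDerivAt x).continuousAt

theorem IsBesselAmplitude.nonneg (hA : IsBesselAmplitude K A A') : 0 ≤ K :=
  (norm_nonneg _).trans (hA.norm_le 0 le_rfl)

theorem IsWeight.nonneg (hw : IsWeight W w w') : 0 ≤ W :=
  (norm_nonneg _).trans (hw.norm_le 1 (by norm_num))

theorem continuous_amplitude_deriv (hA : IsBesselAmplitude K A A') (hw : IsWeight W w w')
    (hb : 0 < b) (t : ℝ) :
    Continuous fun r => w' r * A (t * radialPhase s b r) +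
        w r * ((t * radialPhase₁ s b r : ℝ) * A' (t * radialPhase s b r)) := by
  have := hA.continuous
  have := hA.continuous_deriv
  have := hw.continuous
  have := hw.continuous_deriv
  have := continuous_radialPhase s b
  have := continuous_radialPhase₁ (s := s) hb
  fun_prop

/-- Where the phase is monotone, the substitution ρ = t r D(r) turns the variation of the amplitude
into part of ∫ |A'| dρ, which converges because A' decays like ρ^{-3/2}. Hence there is no
dependence on t, s or b. The sign σ records the direction of monotonicity. -/
theorem integral_norm_amplitude_deriv_le (hA : IsBesselAmplitude K A A') (hw : IsWeight W w w')
    (hb : 0 < b) (ht : 0 < t) {α β σ : ℝ} (hα : 1 / 2 ≤ α) (hαβ : α ≤ β) (hβ : β ≤ 2)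
    (hσ : |σ| = 1) (h : ∀ r ∈ Icc α β, 0 ≤ σ * radialPhase₁ s b r) :
    ∫ r in α..β, ‖w' r * A (t * radialPhase s b r) +
        w r * ((t * radialPhase₁ s b r : ℝ) * A' (t * radialPhase s b r))‖ ≤ 4 * W * K := by
  have hK := hA.nonneg
  have hW := hw.nonneg
  have ρ0 : ∀ r ∈ Icc α β, 0 ≤ t * radialPhase s b r := fun r hr =>
    mul_nonneg ht.le (mul_nonneg (by linarith [hr.1]) (planarDist_pos hb r).le)
  -- An explicit primitive of the majorant W K |t p'| (1 + t p)^{-3/2}.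
  set g : ℝ → ℝ := fun r => -(2 * W * K * σ) * (√(1 + t * radialPhase s b r))⁻¹ with hg
  set g' : ℝ → ℝ := fun r => W * K * σ * (t * radialPhase₁ s b r) /
    ((1 + t * radialPhase s b r) * √(1 + t * radialPhase s b r)) with hg'
  have hd : ∀ r ∈ uIcc α β, HasDerivAt g (g' r) r := by
    intro r hr
    rw [uIcc_of_le hαβ] at hr
    have h1 : 0 < 1 + t * radialPhase s b r := by linarith [ρ0 r hr]
    have h2 := Real.sqrt_pos.2 h1
    convert! ((((((hasDerivAt_radialPhase (s := s) hb r).const_mul t).const_add 1).sqrt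
      h1.ne').inv h2.ne').const_mul (-(2 * W * K * σ))) using 1
    simp only [hg']
    rw [Real.sq_sqrt h1.le]
    field_simp
  have cg' : ContinuousOn g' (Icc α β) := by
    have := continuous_radialPhase s b
    have := continuous_radialPhase₁ (s := s) hb
    refine ContinuousOn.div (by fun_prop) (by fun_prop) fun r hr => ?_
    have h1 : 0 < 1 + t * radialPhase s b r := by linarith [ρ0 r hr]
    positivity
  have ig' : IntervalIntegrable g' volume α β :=
    ContinuousOn.intervalIntegrable (by rwa [uIcc_of_le hαβ])
  have h1 : ∫ r in α..β, ‖w' r * A (t * radialPhase s b r) +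
        w r * ((t * radialPhase₁ s b r : ℝ) * A' (t * radialPhase s b r))‖ ≤
      ∫ r in α..β, (W * K + g' r) := by
    refine integral_mono_on hαβ
      ((continuous_amplitude_deriv hA hw hb t).norm.intervalIntegrable _ _)
      (IntervalIntegrable.add (by simp) ig') fun r hr => ?_
    have hr' : r ∈ Icc (1 / 2 : ℝ) 2 := ⟨hα.trans hr.1, hr.2.trans hβ⟩
    refine (norm_add_le _ _).trans (add_le_add ?_ ?_)
    · rw [norm_mul]
      exact mul_le_mul (hw.norm_deriv_le r hr') (hA.norm_le _ (ρ0 r hr)) (norm_nonneg _) hW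
    · have e : |t * radialPhase₁ s b r| = σ * (t * radialPhase₁ s b r) := by
        rw [← abs_of_nonneg (show 0 ≤ σ * (t * radialPhase₁ s b r) by nlinarith [h r hr]),
          abs_mul σ, hσ, one_mul]
      rw [norm_mul, norm_mul, Complex.norm_real, Real.norm_eq_abs, e]
      have e0 : 0 ≤ σ * (t * radialPhase₁ s b r) := by rw [← e]; exact abs_nonneg _
      calc _ ≤ W * (σ * (t * radialPhase₁ s b r) *
            (K / ((1 + t * radialPhase s b r) * √(1 + t * radialPhase s b r)))) := by
            gcongr
            · exact hw.norm_le r hr'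
            · exact hA.norm_deriv_le _ (ρ0 r hr)
        _ = g' r := by simp only [hg']; ring
  refine h1.trans ?_
  rw [integral_add (by simp) ig', integral_eq_sub_of_hasDerivAt hd ig',
    intervalIntegral.integral_const, smul_eq_mul]
  -- Both boundary values σ(1 + t p)^{-1/2} lie in one interval of length 1, so g varies by at most
  -- 2WK; the term W K (β - α) adds at most 3/2 WK.
  have q : ∀ r ∈ Icc α β, |σ * (√(1 + t * radialPhase s b r))⁻¹ - σ / 2| ≤ 1 / 2 := by
    intro r hr
    have e1 : 1 ≤ √(1 + t * radialPhase s b r) := by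
      rw [Real.one_le_sqrt]; linarith [ρ0 r hr]
    have e2 := inv_le_one_of_one_le₀ e1
    have e3 : 0 ≤ (√(1 + t * radialPhase s b r))⁻¹ := by positivity
    rw [show σ * (√(1 + t * radialPhase s b r))⁻¹ - σ / 2 =
      σ * ((√(1 + t * radialPhase s b r))⁻¹ - 1 / 2) by ring, abs_mul, hσ, one_mul, abs_le]
    constructor <;> linarith
  have qa := abs_le.1 (q α (left_mem_Icc.2 hαβ))
  have qb := abs_le.1 (q β (right_mem_Icc.2 hαβ))
  have hWK : 0 ≤ W * K := mul_nonneg hW hK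
  simp only [hg]
  nlinarith [qa.2, qb.1]

/-- The contribution of an interval on which the radial phase is not stationary. -/
theorem norm_integral_le_of_nonstationary (hA : IsBesselAmplitude K A A') (hw : IsWeight W w w')
    (hb : 0 < b) (ht : 0 < t) {α β σ l : ℝ} (hα : 1 / 2 ≤ α) (hαβ : α ≤ β) (hβ : β ≤ 2)
    (hσ : |σ| = 1) (hl : 0 < l) (h : ∀ r ∈ Icc α β, l ≤ σ * radialPhase₁ s b r) :
    ‖∫ r in α..β, w r * A (t * radialPhase s b r) *
        Complex.exp (Complex.I * (t * radialPhase s b r : ℝ))‖ ≤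
      W * K * (6 / l + 7 / l ^ 2) / t := by
  have hK := hA.nonneg
  have hW := hw.nonneg
  have e : ∀ r ∈ Icc α β, l ≤ |radialPhase₁ s b r| := fun r hr => by
    rw [← one_mul |_|, ← hσ, ← abs_mul]
    exact (h r hr).trans (le_abs_self _)
  have nf : ∀ r ∈ Icc α β, ‖w r * A (t * radialPhase s b r)‖ ≤ W * K := fun r hr => by
    rw [norm_mul]
    exact mul_le_mul (hw.norm_le r ⟨hα.trans hr.1, hr.2.trans hβ⟩) (hA.norm_le _ (mul_nonneg ht.le
      (mul_nonneg (by linarith [hr.1]) (planarDist_pos hb r).le))) (norm_nonneg _) hW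
  have cf' := continuous_amplitude_deriv (s := s) hA hw hb t
  have cp₂ := continuous_radialPhase₂ (s := s) hb
  have cp₁ := continuous_radialPhase₁ (s := s) hb
  have cp := continuous_radialPhase s b
  have cA := hA.continuous
  have cw := hw.continuous
  have core := norm_integral_mul_exp_le (a := α) (b := β) hαβ
    (fun r => (hasDerivAt_radialPhase (s := s) hb r).const_mul t)
    (fun r => (hasDerivAt_radialPhase₁ (s := s) hb r).const_mul t) (by fun_prop)
    (fun r => hasDerivAt_amplitude hA hw hb t r) cf'
    (fun r hr => mul_ne_zero ht.ne' (abs_pos.1 (hl.trans_le (e r hr))))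
  refine core.trans ?_
  have e' : ∀ r ∈ Icc α β, t * l ≤ |t * radialPhase₁ s b r| := fun r hr => by
    rw [abs_mul, abs_of_pos ht]; exact mul_le_mul_of_nonneg_left (e r hr) ht.le
  have tl : 0 < t * l := by positivity
  have q : ∀ r ∈ Icc α β, ‖w r * A (t * radialPhase s b r)‖ / |t * radialPhase₁ s b r| ≤
      W * K / (t * l) := fun r hr =>
    div_le_div₀ (by positivity) (nf r hr) tl (e' r hr)
  have qa := q α (left_mem_Icc.2 hαβ)
  have qb := q β (right_mem_Icc.2 hαβ)
  have I1 : ∀ f' : ℝ → ℂ, Continuous f' → ∫ r in α..β, (‖f' r‖ / |t * radialPhase₁ s b r| +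
      ‖w r * A (t * radialPhase s b r)‖ * |t * radialPhase₂ s b r| / (t * radialPhase₁ s b r) ^ 2)
      ≤ (∫ r in α..β, ‖f' r‖) * (1 / (t * l)) +
        (∫ r in α..β, |radialPhase₂ s b r|) * (W * K * t / (t * l) ^ 2) := by
    intro f' cf'
    rw [← intervalIntegral.integral_mul_const, ← intervalIntegral.integral_mul_const,
      ← integral_add ((by fun_prop : Continuous _).intervalIntegrable _ _)
      ((by fun_prop : Continuous _).intervalIntegrable _ _)]
    refine integral_mono_on hαβ (ContinuousOn.intervalIntegrable ?_)
      ((by fun_prop : Continuous _).intervalIntegrable _ _) fun r hr => ?_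
    · rw [uIcc_of_le hαβ]
      have h0 : ∀ r ∈ Icc α β, t * radialPhase₁ s b r ≠ 0 := fun r hr =>
        abs_pos.1 (tl.trans_le (e' r hr))
      exact ContinuousOn.add (ContinuousOn.div (by fun_prop) (by fun_prop)
          fun r hr => abs_ne_zero.2 (h0 r hr))
        (ContinuousOn.div (by fun_prop) (by fun_prop) fun r hr => pow_ne_zero _ (h0 r hr))
    · refine add_le_add ?_ ?_
      · rw [div_eq_mul_one_div]
        gcongr
        exact e' r hr
      · rw [abs_mul, abs_of_pos ht, ← sq_abs (t * radialPhase₁ s b r)]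
        calc _ ≤ (W * K) * (t * |radialPhase₂ s b r|) / (t * l) ^ 2 := by
              gcongr
              · exact nf r hr
              · exact e' r hr
          _ = _ := by ring
  have I2 := I1 _ cf'
  have I3 := integral_norm_amplitude_deriv_le hA hw hb ht hα hαβ hβ hσ
    (fun r hr => hl.le.trans (h r hr))
  have I4 := integral_abs_radialPhase₂_le (s := s) hb hα hαβ hβ
  calc _ ≤ W * K / (t * l) + W * K / (t * l) +
        (4 * W * K * (1 / (t * l)) + 7 * (W * K * t / (t * l) ^ 2)) := by
        refine add_le_add (add_le_add qb qa) (I2.trans (add_le_add ?_ ?_))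
        · exact mul_le_mul_of_nonneg_right I3 (by positivity)
        · exact mul_le_mul_of_nonneg_right I4 (by positivity)
    _ = _ := by field_simp; ring

/-- The contribution of an interval on which the oscillatory factor alone has small primitive. -/
theorem norm_integral_le_of_oscillation (hA : IsBesselAmplitude K A A') (hw : IsWeight W w w')
    (hb : 0 < b) (ht : 0 < t) {α β Δ M : ℝ} (hα : 1 / 2 ≤ α) (hαβ : α ≤ β) (hβ : β ≤ 2)
    (hΔ : 0 < Δ) (h1 : ∀ r ∈ Icc α β, Δ ≤ planarDist s b r)
    (h2 : ∀ r ∈ Icc α β, planarDist s b r ≤ 7)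
    (hM : ∀ x ∈ Icc α β, ‖∫ r in α..x, Complex.exp (Complex.I * (t * radialPhase s b r : ℝ))‖ ≤ M) :
    ‖∫ r in α..β, w r * A (t * radialPhase s b r) *
        Complex.exp (Complex.I * (t * radialPhase s b r : ℝ))‖ ≤
      M * (W * K / √(t * Δ) * (5 + 36 * (β - α) / Δ)) := by
  have hK := hA.nonneg
  have hW := hw.nonneg
  have cp := continuous_radialPhase s b
  have M0 : 0 ≤ M := (norm_nonneg _).trans (hM α (left_mem_Icc.2 hαβ))
  have cf' := continuous_amplitude_deriv (s := s) hA hw hb t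
  refine (norm_integral_mul_le_of_primitive_le hαβ
    (fun r => hasDerivAt_amplitude (s := s) hA hw hb t r) cf' (by fun_prop) hM).trans ?_
  refine mul_le_mul_of_nonneg_left ?_ M0
  have p1 : ∀ r ∈ Icc α β, t * Δ / 2 ≤ t * radialPhase s b r := fun r hr => by
    have : Δ / 2 ≤ radialPhase s b r := by
      unfold radialPhase
      nlinarith [hr.1, h1 r hr]
    nlinarith
  have tΔ : 0 < t * Δ := by positivity
  have sq : √(t * Δ) / 2 ≤ √(t * Δ / 2) := by
    refine Real.le_sqrt_of_sq_le ?_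
    rw [div_pow, Real.sq_sqrt tΔ.le]; linarith
  have sp := Real.sqrt_pos.2 tΔ
  have nA : ∀ r ∈ Icc α β, ‖A (t * radialPhase s b r)‖ ≤ 2 * K / √(t * Δ) := fun r hr => by
    refine (hA.norm_le_sqrt _ (by linarith [p1 r hr])).trans ?_
    have : √(t * Δ) / 2 ≤ √(t * radialPhase s b r) := sq.trans (Real.sqrt_le_sqrt (p1 r hr))
    calc K / √(t * radialPhase s b r) ≤ K / (√(t * Δ) / 2) := by gcongr
      _ = _ := by field_simp
  have nA' : ∀ r ∈ Icc α β, ‖A' (t * radialPhase s b r)‖ ≤ 4 * K / (t * Δ * √(t * Δ)) :=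
    fun r hr => by
    have h0 : 0 ≤ t * radialPhase s b r := by linarith [p1 r hr]
    refine (hA.norm_deriv_le _ h0).trans ?_
    have : √(t * Δ) / 2 ≤ √(1 + t * radialPhase s b r) :=
      sq.trans (Real.sqrt_le_sqrt (by linarith [p1 r hr]))
    calc _ ≤ K / ((t * Δ / 2) * (√(t * Δ) / 2)) := by
          gcongr
          linarith [p1 r hr]
      _ = _ := by field_simp; norm_num
  have nf' : ∀ r ∈ Icc α β, ‖w' r * A (t * radialPhase s b r) +
        w r * ((t * radialPhase₁ s b r : ℝ) * A' (t * radialPhase s b r))‖ ≤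
      W * K / √(t * Δ) * (2 + 36 / Δ) := fun r hr => by
    have hr' : r ∈ Icc (1 / 2 : ℝ) 2 := ⟨hα.trans hr.1, hr.2.trans hβ⟩
    have h9 : |t * radialPhase₁ s b r| ≤ t * 9 := by
      rw [abs_mul, abs_of_pos ht]
      have := abs_radialPhase₁_le (s := s) hb (by linarith [hr'.1]) hr'.2
      exact mul_le_mul_of_nonneg_left (by linarith [h2 r hr]) ht.le
    calc _ ≤ W * (2 * K / √(t * Δ)) + W * (t * 9 * (4 * K / (t * Δ * √(t * Δ)))) := by
          refine (norm_add_le _ _).trans (add_le_add ?_ ?_)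
          · rw [norm_mul]
            exact mul_le_mul (hw.norm_deriv_le r hr') (nA r hr) (norm_nonneg _) hW
          · rw [norm_mul, norm_mul, Complex.norm_real, Real.norm_eq_abs]
            exact mul_le_mul (hw.norm_le r hr') (mul_le_mul h9 (nA' r hr) (norm_nonneg _)
              (by positivity)) (by positivity) hW
      _ = _ := by field_simp; ring
  have I1 := integral_mono_on hαβ (cf'.norm.intervalIntegrable _ _)
    (intervalIntegrable_const (μ := volume) (c := W * K / √(t * Δ) * (2 + 36 / Δ))) nf'
  rw [intervalIntegral.integral_const, smul_eq_mul] at I1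
  have nfβ : ‖w β * A (t * radialPhase s b β)‖ ≤ W * (2 * K / √(t * Δ)) := by
    rw [norm_mul]
    exact mul_le_mul (hw.norm_le β ⟨hα.trans hαβ, hβ⟩) (nA β (right_mem_Icc.2 hαβ))
      (norm_nonneg _) hW
  have h3 : 0 ≤ W * K / √(t * Δ) := by positivity
  calc _ ≤ W * (2 * K / √(t * Δ)) + (β - α) * (W * K / √(t * Δ) * (2 + 36 / Δ)) :=
        add_le_add nfβ I1
    _ = W * K / √(t * Δ) * (2 + 2 * (β - α) + 36 * (β - α) / Δ) := by ring
    _ ≤ _ := by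
        refine mul_le_mul_of_nonneg_left ?_ h3
        linarith

end amplitude

/-! ### Decomposition of the radial integral around the focus -/

/-- Projection of the real line onto `[1/2, 2]`. -/
noncomputable def clipHalfTwo (y : ℝ) : ℝ := max (1 / 2) (min 2 y)

theorem clipHalfTwo_mem (y : ℝ) : clipHalfTwo y ∈ Icc (1 / 2 : ℝ) 2 :=
  ⟨le_max_left _ _, max_le (by norm_num) (min_le_left _ _)⟩

theorem clipHalfTwo_mono {x y : ℝ} (h : x ≤ y) : clipHalfTwo x ≤ clipHalfTwo y :=
  max_le_max le_rfl (min_le_min le_rfl h)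

/-- The cut points depend on s and b and may fall outside [1/2, 2]. A clipped piece of positive
length still lies inside the unclipped one, so the estimates there apply to it. -/
theorem bounds_of_clipHalfTwo_lt {x y : ℝ} (h : clipHalfTwo x < clipHalfTwo y) :
    x ≤ clipHalfTwo x ∧ clipHalfTwo y ≤ y := by
  unfold clipHalfTwo at *
  constructor
  · rcases le_total 2 x with h2 | h2
    · rw [min_eq_left h2] at h
      exact absurd h (not_lt.2 (max_le_max le_rfl (min_le_left _ _)))
    · rw [min_eq_right h2]; exact le_max_right _ _
  · rcases le_total y (1 / 2) with h2 | h2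
    · rw [max_eq_left ((min_le_right _ _).trans h2)] at h
      exact absurd h (not_lt.2 (le_max_left _ _))
    · exact max_le h2 (min_le_right _ _)

theorem norm_integral_clipHalfTwo_le {g : ℝ → ℂ} {x y B : ℝ} (hxy : x ≤ y) (hB : 0 ≤ B)
    (h : ∀ α β, 1 / 2 ≤ α → α ≤ β → β ≤ 2 → x ≤ α → β ≤ y → ‖∫ r in α..β, g r‖ ≤ B) :
    ‖∫ r in (clipHalfTwo x)..(clipHalfTwo y), g r‖ ≤ B := by
  rcases (clipHalfTwo_mono hxy).eq_or_lt with e | e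
  · rw [e, integral_same, norm_zero]; exact hB
  · have := bounds_of_clipHalfTwo_lt e
    exact h _ _ (clipHalfTwo_mem x).1 e.le (clipHalfTwo_mem y).2 this.1 this.2

section
variable {K W : ℝ} {A A' w w' : ℝ → ℂ} {s b t : ℝ}

/-- With |r - s| ≤ b one has D² ≤ 2b², so the positive term r b²/D³ of p'' dominates: over the
denominator D³ ≤ 3b³, the numerator is at least b²/2 - 4b³ ≥ b²/4. Thus p'' ≥ 1/(12b), and η =
(b/t)^{1/2} balances the order-two estimate. -/
theorem vanDerCorput_near_focus (hb : 0 < b) (hb' : b ≤ 1 / 16) (ht : 0 < t) {α β : ℝ}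
    (hα : 1 / 2 ≤ α) (hαβ : α ≤ β) (h1 : s - b ≤ α) (h2 : β ≤ s + b) :
    ‖∫ r in α..β, Complex.exp (Complex.I * (t * radialPhase s b r : ℝ))‖ ≤ 98 * √(b / t) := by
  have e0 : 0 < √(b / t) := Real.sqrt_pos.2 (by positivity)
  have cp₂ := continuous_radialPhase₂ (s := s) hb
  have := vanDerCorput_two (p := fun r => t * radialPhase s b r) (m := t / (12 * b)) (η := √(b / t))
    hαβ (by positivity) e0
    (fun r => (hasDerivAt_radialPhase (s := s) hb r).const_mul t)
    (fun r => (hasDerivAt_radialPhase₁ (s := s) hb r).const_mul t) (by fun_prop) fun r hr => ?_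
  · refine this.trans (le_of_eq ?_)
    have h3 : √(b / t) * √(b / t) = b / t := Real.mul_self_sqrt (by positivity)
    have h4 : 8 / (t / (12 * b) * √(b / t)) = 96 * √(b / t) := by
      rw [div_eq_iff (by positivity)]
      have : 96 * √(b / t) * (t / (12 * b) * √(b / t)) =
        8 * (√(b / t) * √(b / t)) * (t / b) := by field_simp; norm_num
      rw [this, h3]; field_simp
    rw [h4]; ring
  · have hD := planarDist_pos (s := s) hb r
    have hsq := planarDist_sq s b r
    set D := planarDist s b r with hDdef
    have u1 : |r - s| ≤ b := abs_le.2 ⟨by linarith [hr.1], by linarith [hr.2]⟩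
    have u2 : (r - s) ^ 2 ≤ b ^ 2 := by rw [← sq_abs]; gcongr
    have D2 : D ^ 2 ≤ 2 * b ^ 2 := by linarith
    have D15 : D ≤ 3 / 2 * b := by nlinarith
    have key : 1 / (12 * b) ≤ radialPhase₂ s b r := by
      have e : radialPhase₂ s b r = (2 * (r - s) * D ^ 2 + r * b ^ 2) / D ^ 3 := by
        unfold radialPhase₂; rw [← hDdef]; field_simp
      rw [e, div_le_div_iff₀ (by positivity) (by positivity)]
      have a1 : -(4 * b ^ 3) ≤ 2 * (r - s) * D ^ 2 := by
        nlinarith [(abs_le.1 u1).1, sq_nonneg D]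
      have a2 : b ^ 2 / 2 ≤ r * b ^ 2 := by nlinarith [hr.1, sq_nonneg b]
      have a3 : b ^ 3 ≤ b ^ 2 / 16 := by nlinarith [sq_nonneg b]
      have a4 : D ^ 3 ≤ 3 * b ^ 3 := by nlinarith [sq_nonneg D]
      have a5 : b ^ 2 / 4 ≤ 2 * (r - s) * D ^ 2 + r * b ^ 2 := by linarith
      nlinarith
    calc t / (12 * b) = t * (1 / (12 * b)) := by ring
      _ ≤ _ := mul_le_mul_of_nonneg_left key ht.le

/-- All parts of the radial integral except those where the phase is degenerate or stationary away
from the focus contribute `O(1/t)`. -/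
theorem norm_radial_integral_le_add (hA : IsBesselAmplitude K A A') (hw : IsWeight W w w')
    (hb : 0 < b) (ht : 0 < t) {R : ℝ} (hR : 0 ≤ R)
    (H : ∀ α β, 1 / 2 ≤ α → α ≤ β → β ≤ 2 → (∀ r ∈ Icc α β, planarDist s b r ≤ 7) →
      ((1 / 128 ≤ b ∧ β ≤ s) ∨ (b ≤ 1 / 128 ∧ β ≤ s - 1 / 16)) →
      ‖∫ r in α..β, w r * A (t * radialPhase s b r) *
        Complex.exp (Complex.I * (t * radialPhase s b r : ℝ))‖ ≤ R) :
    ‖∫ r in (1 / 2 : ℝ)..2, w r * A (t * radialPhase s b r) *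
        Complex.exp (Complex.I * (t * radialPhase s b r : ℝ))‖ ≤
      300000 * (W * K / t) + R := by
  have hK := hA.nonneg
  have hW := hw.nonneg
  have h0 : 0 ≤ W * K / t := by positivity
  have cA := hA.continuous
  have cw := hw.continuous
  have cp := continuous_radialPhase s b
  have N : ∀ α β σ : ℝ, 1 / 2 ≤ α → α ≤ β → β ≤ 2 → |σ| = 1 →
      (∀ r ∈ Icc α β, 1 / 128 ≤ σ * radialPhase₁ s b r) →
      ‖∫ r in α..β, w r * A (t * radialPhase s b r) *
        Complex.exp (Complex.I * (t * radialPhase s b r : ℝ))‖ ≤ 115456 * (W * K / t) := by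
    -- 115456 = 6·128 + 7·128², from the nonstationary bound with l = 1/128.
    intro α β σ h1 h2 h3 h4 h5
    refine (norm_integral_le_of_nonstationary hA hw hb ht h1 h2 h3 h4
      (by norm_num : (0 : ℝ) < 1 / 128) h5).trans (le_of_eq ?_)
    ring
  have hD := planarDist_pos (s := s) hb
  have hsq := planarDist_sq s b
  have e₁ : ∀ r, radialPhase₁ s b r = (planarDist s b r ^ 2 + r * (r - s)) / planarDist s b r :=
    fun r => by
      have := (hD r).ne'
      unfold radialPhase₁; field_simp
  -- If the focus is far away, D ≥ 5 on [1/2, 2] and p' ≥ D - 2 ≥ 3, so nothing is stationary.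
  -- Otherwise D ≤ 7 throughout.
  rcases le_or_gt 6 (planarDist s b 1) with h6 | h6
  · refine (N (1 / 2) 2 1 le_rfl (by norm_num) le_rfl abs_one fun r hr => ?_).trans (by linarith)
    have d5 : 5 ≤ planarDist s b r := by
      have := planarDist_le_add s b 1 r
      have : |1 - r| ≤ 1 := abs_le.2 ⟨by linarith [hr.2], by linarith [hr.1]⟩
      linarith
    have := (abs_le.1 (abs_sub_div_planarDist_le (s := s) hb r)).1
    unfold radialPhase₁
    nlinarith [hr.1, hr.2]
  have d7 : ∀ r ∈ Icc (1 / 2 : ℝ) 2, planarDist s b r ≤ 7 := fun r hr => by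
    have := planarDist_le_add s b r 1
    have : |r - 1| ≤ 1 := abs_le.2 ⟨by linarith [hr.1], by linarith [hr.2]⟩
    linarith
  set g : ℝ → ℂ := fun r => w r * A (t * radialPhase s b r) *
        Complex.exp (Complex.I * (t * radialPhase s b r : ℝ)) with hg
  have ig : ∀ x y, IntervalIntegrable g volume x y := fun x y =>
    (by fun_prop : Continuous g).intervalIntegrable _ _
  have c1 : clipHalfTwo (1 / 2) = 1 / 2 := by unfold clipHalfTwo; norm_num
  have c2 : clipHalfTwo 2 = 2 := by unfold clipHalfTwo; norm_num
  have hleft : ∀ y, ((1 / 128 ≤ b ∧ y ≤ s) ∨ (b ≤ 1 / 128 ∧ y ≤ s - 1 / 16)) →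
      ‖∫ r in (1 / 2)..(clipHalfTwo y), g r‖ ≤ R := by
    intro y hy
    have hle := (clipHalfTwo_mem y).1
    rcases hle.eq_or_lt with e | e
    · rw [← e, integral_same, norm_zero]; exact hR
    · have h2 : clipHalfTwo y ≤ y := (bounds_of_clipHalfTwo_lt (x := 1 / 2) (by rwa [c1])).2
      refine H _ _ le_rfl e.le (clipHalfTwo_mem y).2
        (fun r hr => d7 r ⟨hr.1, hr.2.trans (clipHalfTwo_mem y).2⟩) ?_
      rcases hy with hy | hy
      · exact Or.inl ⟨hy.1, h2.trans hy.2⟩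
      · exact Or.inr ⟨hy.1, h2.trans hy.2⟩
  have hright : ∀ y, ((1 / 128 ≤ b ∧ s ≤ y) ∨ s + b ≤ y) →
      ‖∫ r in (clipHalfTwo y)..2, g r‖ ≤ 115456 * (W * K / t) := by
    intro y hy
    have hle := (clipHalfTwo_mem y).2
    rcases hle.eq_or_lt with e | e
    · rw [e, integral_same, norm_zero]; positivity
    · have h2 : y ≤ clipHalfTwo y := (bounds_of_clipHalfTwo_lt (y := 2) (by rwa [c2])).1
      refine N _ _ 1 (clipHalfTwo_mem y).1 e.le le_rfl abs_one fun r hr => ?_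
      have r1 : 1 / 2 ≤ r := (clipHalfTwo_mem y).1.trans hr.1
      have r2 : y ≤ r := h2.trans hr.1
      rw [one_mul, e₁, le_div_iff₀ (hD r)]
      rcases hy with hy | hy
      · have := le_planarDist s b r
        nlinarith [hD r]
      · have D15 : planarDist s b r ≤ 3 / 2 * (r - s) := by nlinarith [hD r, hsq r]
        nlinarith [hD r, sq_nonneg (planarDist s b r)]
  -- For b ≥ 1/128 one cut at s suffices, as p' ≥ D ≥ b to its right. For smaller b the cuts are s -
  -- 1/16, s - b and s + b; only the leftmost piece is left to `H`.
  rcases le_or_gt (1 / 128) b with hb1 | hb1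
  · rw [← integral_add_adjacent_intervals (ig (1 / 2) (clipHalfTwo s)) (ig _ 2)]
    refine (norm_add_le _ _).trans ?_
    linarith [hleft s (Or.inl ⟨hb1, le_rfl⟩), hright s (Or.inl ⟨hb1, le_rfl⟩)]
  · have k1 := hleft (s - 1 / 16) (Or.inr ⟨hb1.le, le_rfl⟩)
    have k4 := hright (s + b) (Or.inr le_rfl)
    have k2 : ‖∫ r in (clipHalfTwo (s - 1 / 16))..(clipHalfTwo (s - b)), g r‖ ≤
        115456 * (W * K / t) := by
      refine norm_integral_clipHalfTwo_le (by linarith) (by positivity)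
        fun α β hα hαβ hβ h1 h2 => N _ _ (-1) hα hαβ hβ (by norm_num) fun r hr => ?_
      have r1 : 1 / 2 ≤ r := hα.trans hr.1
      have u1 : r - s ≤ -b := by linarith [hr.2]
      have u2 : -(1 / 16) ≤ r - s := by linarith [hr.1]
      -- With u = r - s in [-1/16, -b]: D² ≤ 2u² ≤ |u|/8 while r|u| ≥ |u|/2, so -p' ≥ (3/8)|u|/D ≥
      -- 1/4.
      have D15 : planarDist s b r ≤ 3 / 2 * -(r - s) := by nlinarith [hD r, hsq r]
      have D2 : planarDist s b r ^ 2 ≤ 1 / 8 * -(r - s) := by nlinarith [hsq r]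
      rw [e₁, neg_one_mul, ← neg_div, le_div_iff₀ (hD r)]
      nlinarith
    have k3 : ‖∫ r in (clipHalfTwo (s - b))..(clipHalfTwo (s + b)), g r‖ ≤
        7546 * (W * K / t) := by
      refine norm_integral_clipHalfTwo_le (by linarith) (by positivity)
        fun α β hα hαβ hβ h1 h2 => ?_
      refine (norm_integral_le_of_oscillation hA hw hb ht hα hαβ hβ hb
        (fun r _ => le_planarDist s b r) (fun r hr => d7 r ⟨hα.trans hr.1, hr.2.trans hβ⟩)
        (fun x hx => vanDerCorput_near_focus hb (by linarith) ht hα hx.1 h1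
          (hx.2.trans h2))).trans ?_
      have e1 : 36 * (β - α) / b ≤ 72 := by
        rw [div_le_iff₀ hb]; linarith
      -- The powers of b in the oscillation and in the amplitude cancel, which makes the bound
      -- uniform as the focus approaches the axis.
      have e2 : √(b / t) / √(t * b) = 1 / t := by
        rw [← Real.sqrt_div (by positivity), show b / t / (t * b) = (1 / t) ^ 2 by field_simp,
          Real.sqrt_sq (by positivity)]
      calc _ ≤ 98 * √(b / t) * (W * K / √(t * b) * (5 + 72)) := by gcongr
        _ = 7546 * (W * K * (√(b / t) / √(t * b))) := by ring
        _ = _ := by rw [e2]; ring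
    rw [← integral_add_adjacent_intervals (ig (1 / 2) (clipHalfTwo (s - 1 / 16))) (ig _ 2),
      ← integral_add_adjacent_intervals (ig (clipHalfTwo (s - 1 / 16)) (clipHalfTwo (s - b)))
        (ig _ 2),
      ← integral_add_adjacent_intervals (ig (clipHalfTwo (s - b)) (clipHalfTwo (s + b))) (ig _ 2)]
    refine (norm_add_le _ _).trans ?_
    refine (add_le_add_right ((norm_add_le _ _).trans (add_le_add_right (norm_add_le _ _) _))
      _).trans ?_
    linarith

/-- The radial integral decays like `1/t` when the amplitude decays like `1/ρ`. -/
theorem norm_radial_integral_le (hA : IsBesselAmplitude K A A')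
    (hA1 : ∀ ρ, 0 < ρ → ‖A ρ‖ ≤ K / ρ) (hw : IsWeight W w w') (hb : 0 < b) (ht : 0 < t) :
    ‖∫ r in (1 / 2 : ℝ)..2, w r * A (t * radialPhase s b r) *
        Complex.exp (Complex.I * (t * radialPhase s b r : ℝ))‖ ≤ 301000 * (W * K / t) := by
  have hK := hA.nonneg
  have hW := hw.nonneg
  have h0 : 0 ≤ W * K / t := by positivity
  refine (norm_radial_integral_le_add hA hw hb ht (R := 1000 * (W * K / t)) (by positivity)
    fun α β hα hαβ hβ _ h => ?_).trans (by linarith)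
  -- Away from the focus t r D(r) ≥ t/256, so the pointwise bound on the amplitude is already O(1/t)
  -- and no oscillation is needed.
  have d : ∀ r ∈ Icc α β, 1 / 128 ≤ planarDist s b r := fun r hr => by
    rcases h with h | h
    · exact h.1.trans (le_planarDist s b r)
    · have := (neg_le_abs _).trans (abs_sub_le_planarDist s b r)
      linarith [hr.2]
  have := norm_integral_le_of_norm_le_const (a := α) (b := β) (C := 256 * (W * K / t))
    (f := fun r => w r * A (t * radialPhase s b r) *
        Complex.exp (Complex.I * (t * radialPhase s b r : ℝ))) fun r hr => ?_
  · refine this.trans ?_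
    rw [abs_of_nonneg (by linarith)]
    nlinarith
  · rw [uIoc_of_le hαβ] at hr
    have p1 : t * (1 / 256) ≤ t * radialPhase s b r := by
      refine mul_le_mul_of_nonneg_left ?_ ht.le
      unfold radialPhase
      nlinarith [hr.1, d r ⟨hr.1.le, hr.2⟩]
    rw [norm_mul, norm_mul, norm_exp_I_mul, mul_one]
    calc _ ≤ W * (K / (t * (1 / 256))) := by
          refine mul_le_mul (hw.norm_le r ⟨hα.trans hr.1.le, hr.2.trans hβ⟩) ((hA1 _ ?_).trans ?_)
            (norm_nonneg _) hW
          · nlinarith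
          · gcongr
      _ = _ := by field_simp

/-- The radial integral decays like `t^{-5/6}` when the amplitude decays like `ρ^{-1/2}`. -/
theorem norm_radial_integral_le_rpow (hA : IsBesselAmplitude K A A') (hw : IsWeight W w w')
    (hb : 0 < b) (ht : 1 ≤ t) :
    ‖∫ r in (1 / 2 : ℝ)..2, w r * A (t * radialPhase s b r) *
        Complex.exp (Complex.I * (t * radialPhase s b r : ℝ))‖ ≤
      10 ^ 14 * (W * K * t ^ (-(5 / 6) : ℝ)) := by
  have hK := hA.nonneg
  have hW := hw.nonneg
  have t0 : 0 < t := by linarith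
  -- The scale at which the three terms of the order-three estimate balance: t τ³ = 1.
  set τ : ℝ := t ^ (-(1 / 3) : ℝ) with hτ
  have τ0 : 0 < τ := by positivity
  have τ3 : t * τ ^ 3 = 1 := by
    rw [hτ, ← Real.rpow_natCast, ← Real.rpow_mul t0.le]
    norm_num
    rw [Real.rpow_neg_one, mul_inv_cancel₀ t0.ne']
  have tst : t ^ (-(5 / 6) : ℝ) = τ * (1 / √t) := by
    rw [hτ, Real.sqrt_eq_rpow, one_div (t ^ _), ← Real.rpow_neg t0.le, ← Real.rpow_add t0]
    norm_num
  have st0 := Real.sqrt_pos.2 t0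
  have inv_le : 1 / t ≤ t ^ (-(5 / 6) : ℝ) := by
    rw [one_div, ← Real.rpow_neg_one]
    exact Real.rpow_le_rpow_of_exponent_le ht (by norm_num)
  have sτ : 1 / √t ≤ τ := by
    rw [hτ, Real.sqrt_eq_rpow, one_div (t ^ _), ← Real.rpow_neg t0.le]
    exact Real.rpow_le_rpow_of_exponent_le ht (by norm_num)
  have h0 : 0 ≤ W * K * t ^ (-(5 / 6) : ℝ) := by positivity
  have h1 : W * K / t ≤ W * K * t ^ (-(5 / 6) : ℝ) := by
    rw [div_eq_mul_one_div]; exact mul_le_mul_of_nonneg_left inv_le (by positivity)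
  refine (norm_radial_integral_le_add hA hw hb t0
    (R := 10 ^ 13 * (W * K * t ^ (-(5 / 6) : ℝ))) (by positivity)
    fun α β hα hαβ hβ d7 h => ?_).trans (by linarith)
  have hD := planarDist_pos (s := s) hb
  have hsq := planarDist_sq s b
  have d : ∀ r ∈ Icc α β, 1 / 128 ≤ planarDist s b r := fun r hr => by
    rcases h with h | h
    · exact h.1.trans (le_planarDist s b r)
    · have := (neg_le_abs _).trans (abs_sub_le_planarDist s b r)
      linarith [hr.2]
  have osc : ∀ x ∈ Icc α β,
      ‖∫ r in α..x, Complex.exp (Complex.I * (t * radialPhase s b r : ℝ))‖ ≤ 40000000 * τ := by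
    intro x hx
    -- If b ≥ 1/128, then p''' ≥ 3b²/D³ ≥ 1/2000000 and the order-three estimate gives t^{-1/3}. If
    -- b is small, the term 2(r - s)/D makes p'' ≤ -1/112, and the order-two estimate gives the
    -- better t^{-1/2}.
    rcases h with h | h
    · have := vanDerCorput_three (p := fun r => t * radialPhase s b r) (m := t * (1 / 2000000))
        (η := τ) (κ := τ) hx.1 (by positivity) τ0 τ0
        (fun r => (hasDerivAt_radialPhase (s := s) hb r).const_mul t)
        (fun r => (hasDerivAt_radialPhase₁ (s := s) hb r).const_mul t)
        (fun r => (hasDerivAt_radialPhase₂ (s := s) hb r).const_mul t) fun r hr => ?_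
      · refine this.trans ?_
        have : 8 / (t * (1 / 2000000) * τ * τ) = 16000000 * τ := by
          rw [div_eq_iff (by positivity)]
          linear_combination (-8) * τ3
        rw [this]
        linarith
      · have hx' : r ∈ Icc α β := ⟨hr.1, hr.2.trans hx.2⟩
        have D0 := hD r
        refine mul_le_mul_of_nonneg_left ?_ t0.le
        unfold radialPhase₃
        rw [le_div_iff₀ (by positivity)]
        have a1 : 0 ≤ r * (s - r) := mul_nonneg (by linarith [hr.1]) (by linarith [hx'.2, h.2])
        have a2 : (1 / 128) ^ 2 ≤ b ^ 2 := pow_le_pow_left₀ (by norm_num) h.1 2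
        have a3 : planarDist s b r ^ 3 ≤ 7 ^ 3 := pow_le_pow_left₀ D0.le (d7 r hx') 3
        calc _ = 1 / 2000000 * planarDist s b r ^ 3 * planarDist s b r ^ 2 := by ring
          _ ≤ 3 * b ^ 2 * planarDist s b r ^ 2 :=
            mul_le_mul_of_nonneg_right (by linarith) (by positivity)
          _ ≤ _ := by gcongr; linarith
    · have := vanDerCorput_two_neg (p := fun r => t * radialPhase s b r) (m := t * (1 / 112))
        (η := 1 / √t) hx.1 (by positivity) (by positivity)
        (fun r => (hasDerivAt_radialPhase (s := s) hb r).const_mul t)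
        (fun r => (hasDerivAt_radialPhase₁ (s := s) hb r).const_mul t)
        (continuous_const.mul (continuous_radialPhase₂ hb)) fun r hr => ?_
      · refine this.trans ?_
        have : 8 / (t * (1 / 112) * (1 / √t)) = 896 * (1 / √t) := by
          rw [div_eq_iff (by positivity)]
          have := Real.mul_self_sqrt t0.le
          field_simp
          linarith
        rw [this]
        linarith
      · have hx' : r ∈ Icc α β := ⟨hr.1, hr.2.trans hx.2⟩
        have D0 := hD r
        have hu : r - s ≤ -(1 / 16) := by linarith [hx'.2, h.2]
        have a0 : b ^ 2 ≤ (1 / 128) ^ 2 := pow_le_pow_left₀ hb.le h.1 2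
        have a1 : (1 / 16) ^ 2 ≤ planarDist s b r ^ 2 := by
          rw [hsq]; nlinarith [sq_nonneg b]
        have e : radialPhase₂ s b r =
            (2 * (r - s) * planarDist s b r ^ 2 + r * b ^ 2) / planarDist s b r ^ 3 := by
          unfold radialPhase₂; field_simp
        have key : radialPhase₂ s b r ≤ -(1 / 112) := by
          rw [e, div_le_iff₀ (by positivity)]
          have a2 : 2 * (r - s) * planarDist s b r ^ 2 ≤ -(1 / 8) * planarDist s b r ^ 2 :=
            mul_le_mul_of_nonneg_right (by linarith) (by positivity)
          have a3 : r * b ^ 2 ≤ 2 * (1 / 128) ^ 2 :=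
            mul_le_mul (by linarith [hx'.2]) a0 (by positivity) (by norm_num)
          have a4 : planarDist s b r ^ 3 ≤ 7 * planarDist s b r ^ 2 := by
            rw [pow_succ, mul_comm]
            exact mul_le_mul_of_nonneg_right (d7 r hx') (by positivity)
          nlinarith
        nlinarith
  refine (norm_integral_le_of_oscillation hA hw hb t0 hα hαβ hβ
    (by norm_num : (0 : ℝ) < 1 / 128) d d7 osc).trans ?_
  have q1 : √t / 12 ≤ √(t * (1 / 128)) := by
    refine Real.le_sqrt_of_sq_le ?_
    rw [div_pow, Real.sq_sqrt t0.le]; linarith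
  have q2 : 5 + 36 * (β - α) / (1 / 128) ≤ 6917 := by
    have : β - α ≤ 3 / 2 := by linarith
    rw [div_eq_mul_inv]; norm_num; linarith
  calc _ ≤ 40000000 * τ * (W * K / (√t / 12) * 6917) := by gcongr
    _ = 3320160000000 * (W * K * (τ * (1 / √t))) := by field_simp; ring
    _ ≤ _ := by
      rw [← tst]
      exact mul_le_mul_of_nonneg_right (by norm_num) h0
end

/-! ### The Fourier transform of the sphere and its amplitude -/

theorem norm_exp_I_mul_ofReal_mul (x y : ℝ) : ‖Complex.exp (Complex.I * (x * y))‖ = 1 := by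
  have := norm_exp_I_mul (x * y)
  rwa [Complex.ofReal_mul] at this

theorem hasDerivAt_integral_mul_exp {g : ℝ → ℂ} {h : ℝ → ℝ} (hg : Continuous g)
    (hh : Continuous h) {a b : ℝ} (ρ : ℝ) :
    HasDerivAt (fun ρ : ℝ => ∫ θ in a..b, g θ * Complex.exp (Complex.I * (ρ * h θ)))
      (∫ θ in a..b, g θ * (Complex.I * h θ * Complex.exp (Complex.I * (ρ * h θ)))) ρ := by
  refine (intervalIntegral.hasDerivAt_integral_of_dominated_loc_of_deriv_le (μ := volume) (s := univ)
    (F' := fun (ρ θ : ℝ) => g θ * (Complex.I * h θ * Complex.exp (Complex.I * (ρ * h θ))))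
    (bound := fun θ => ‖g θ‖ * |h θ|) Filter.univ_mem
    (Filter.Eventually.of_forall fun x => ?_) ?_ ?_ ?_ ?_ ?_).2
  · exact (by fun_prop : Continuous _).aestronglyMeasurable
  · exact (by fun_prop : Continuous _).intervalIntegrable _ _
  · exact (by fun_prop : Continuous _).aestronglyMeasurable
  · refine Filter.Eventually.of_forall fun θ _ x _ => le_of_eq ?_
    rw [norm_mul, norm_mul, norm_exp_I_mul_ofReal_mul]
    simp
  · exact (by fun_prop : Continuous _).intervalIntegrable _ _
  · refine Filter.Eventually.of_forall fun θ _ x _ => ?_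
    have h1 : HasDerivAt (fun x : ℝ => Complex.I * ((x : ℂ) * h θ)) (Complex.I * h θ) x := by
      simpa using ((Complex.ofRealCLM.hasDerivAt (x := x)).mul_const (h θ : ℂ)).const_mul Complex.I
    convert! (h1.cexp).const_mul (g θ) using 1
    ring

/-- Up to a constant, the Fourier transform of the unit sphere of dimension `n + 1`. -/
noncomputable def sphereTransform (n : ℕ) (ρ : ℝ) : ℂ :=
  ∫ θ in (0 : ℝ)..Real.pi, (Real.sin θ ^ n : ℝ) * Complex.exp (Complex.I * (ρ * Real.cos θ))

/-- On [0, π/2] the only stationary point is θ = 0. Beyond θ = ρ^{-1/2}, the inequality sin θ ≥ 2θ/π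
gives a phase derivative at least (2/π)ρ^{1/2}, and 4π/2 ≤ 6.5. The phase is negated to make its
second derivative ρ cos θ nonnegative. -/
theorem norm_integral_exp_cos_le_of_le_half {ρ : ℝ} (hρ : 0 < ρ) {x : ℝ}
    (hx : x ∈ Icc 0 (Real.pi / 2)) :
    ‖∫ θ in (0 : ℝ)..x, Complex.exp (Complex.I * (ρ * Real.cos θ : ℝ))‖ ≤ 15 / √ρ := by
  have hs := Real.sqrt_pos.2 hρ
  have hss := Real.mul_self_sqrt hρ.le
  have hpi := Real.pi_pos
  have hpi' := Real.pi_lt_d2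
  have := norm_integral_le_of_split
    (E := fun θ => Complex.exp (Complex.I * (ρ * Real.cos θ : ℝ))) (by fun_prop)
    (fun θ => (norm_exp_I_mul _).le) (a := 0) (b := x) (c := 0) (η := 1 / √ρ) (B := 6.5 / √ρ)
    ⟨le_rfl, hx.1⟩ (by positivity) (by positivity)
    (fun h => absurd h (by rw [not_le, zero_sub]; exact neg_lt_zero.2 (by positivity)))
    (fun h => ?_)
  · refine this.trans (le_of_eq ?_)
    ring
  · rw [← norm_integral_exp_neg]
    have h1 := vanDerCorput_one (p := fun θ => -(ρ * Real.cos θ))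
      (p' := fun θ => ρ * Real.sin θ) (p'' := fun θ => ρ * Real.cos θ) (l := 2 / Real.pi * √ρ)
      h (by positivity)
      (fun θ => by convert! ((Real.hasDerivAt_cos θ).const_mul ρ).neg using 1; ring)
      (fun θ => (Real.hasDerivAt_sin θ).const_mul ρ) (by fun_prop) (fun θ hθ => ?_) (fun θ hθ => ?_)
    · refine h1.trans ?_
      rw [div_le_div_iff₀ (by positivity) hs]
      have : 6.5 * (2 / Real.pi * √ρ) = (13 / Real.pi) * √ρ := by ring
      rw [this]
      refine mul_le_mul_of_nonneg_right ?_ hs.le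
      rw [le_div_iff₀ hpi]
      linarith
    · have h0 : 0 ≤ θ := le_trans (by positivity) hθ.1
      have h2 := Real.mul_le_sin h0 (hθ.2.trans hx.2)
      have h3 : 1 / √ρ ≤ θ := by linarith [hθ.1]
      refine le_trans ?_ (le_abs_self _)
      calc 2 / Real.pi * √ρ = ρ * (2 / Real.pi * (1 / √ρ)) := by
            field_simp; linarith
        _ ≤ ρ * (2 / Real.pi * θ) := by gcongr
        _ ≤ _ := by gcongr
    · have h0 : 0 ≤ θ := le_trans (by positivity) hθ.1
      exact mul_nonneg hρ.le (Real.cos_nonneg_of_neg_pi_div_two_le_of_le (by linarith)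
        (hθ.2.trans hx.2))

theorem norm_integral_exp_cos_le {ρ : ℝ} (hρ : 0 < ρ) {x : ℝ} (hx : x ∈ Icc 0 Real.pi) :
    ‖∫ θ in (0 : ℝ)..x, Complex.exp (Complex.I * (ρ * Real.cos θ : ℝ))‖ ≤ 45 / √ρ := by
  have hpi := Real.pi_pos
  have hs : 0 < 1 / √ρ := by have := Real.sqrt_pos.2 hρ; positivity
  have e45 : 45 / √ρ = 45 * (1 / √ρ) := by ring
  have e15 : 15 / √ρ = 15 * (1 / √ρ) := by ring
  have half := fun y hy => norm_integral_exp_cos_le_of_le_half hρ (x := y) hy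
  rw [e15] at half
  rw [e45]
  rcases le_total x (Real.pi / 2) with h | h
  · exact (half x ⟨hx.1, h⟩).trans (by linarith)
  set E : ℝ → ℂ := fun θ => Complex.exp (Complex.I * (ρ * Real.cos θ : ℝ)) with hE
  have iE : ∀ x y, IntervalIntegrable E volume x y := fun x y =>
    (by fun_prop : Continuous E).intervalIntegrable _ _
  -- The reflection θ ↦ π - θ moves the other stationary point π to 0 and conjugates the
  -- exponential.
  have e1 : (∫ θ in (Real.pi / 2)..x, E θ) =
      ∫ θ in (Real.pi - x)..(Real.pi / 2), Complex.exp (Complex.I * (-(ρ * Real.cos θ) : ℝ)) := by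
    have := integral_comp_sub_left (a := Real.pi - x) (b := Real.pi / 2) E Real.pi
    rw [show Real.pi - Real.pi / 2 = Real.pi / 2 by ring, sub_sub_cancel] at this
    rw [← this]
    simp only [hE, Real.cos_pi_sub, mul_neg]
  have e2 : ‖∫ θ in (Real.pi / 2)..x, E θ‖ ≤ 30 * (1 / √ρ) := by
    rw [e1, norm_integral_exp_neg (fun θ => ρ * Real.cos θ),
      ← integral_interval_sub_left (iE 0 _) (iE 0 _)]
    refine (norm_sub_le _ _).trans ?_
    linarith [half (Real.pi / 2) ⟨by linarith, le_rfl⟩,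
      half (Real.pi - x) ⟨by linarith [hx.2], by linarith⟩]
  rw [← integral_add_adjacent_intervals (iE 0 (Real.pi / 2)) (iE _ x)]
  refine (norm_add_le _ _).trans ?_
  linarith [half (Real.pi / 2) ⟨by linarith, le_rfl⟩]

theorem norm_integral_mul_exp_cos_le {g g' : ℝ → ℂ} (hg : ∀ θ, HasDerivAt g (g' θ) θ)
    (hg' : Continuous g') :
    ∃ C, 0 ≤ C ∧ ∀ ρ : ℝ, 0 < ρ →
      ‖∫ θ in (0 : ℝ)..Real.pi, g θ * Complex.exp (Complex.I * (ρ * Real.cos θ))‖ ≤ C / √ρ := by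
  refine ⟨45 * (‖g Real.pi‖ + ∫ θ in (0 : ℝ)..Real.pi, ‖g' θ‖), ?_, fun ρ hρ => ?_⟩
  · have : 0 ≤ ∫ θ in (0 : ℝ)..Real.pi, ‖g' θ‖ :=
      integral_nonneg Real.pi_pos.le fun θ _ => norm_nonneg _
    positivity
  · have := norm_integral_mul_le_of_primitive_le
      (E := fun θ => Complex.exp (Complex.I * (ρ * Real.cos θ : ℝ))) Real.pi_pos.le hg hg'
      (by fun_prop) (fun x hx => norm_integral_exp_cos_le hρ hx)
    push_cast at this ⊢
    refine this.trans (le_of_eq ?_)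
    ring

/-- A factor sin θ makes the oscillating factor an exact derivative, cancelling the degeneracy at
both stationary points: each such factor allows one integration by parts. -/
theorem integral_mul_sin_mul_exp_cos {g g' : ℝ → ℂ} (hg : ∀ θ, HasDerivAt g (g' θ) θ)
    (hg' : Continuous g') (ρ : ℝ) :
    Complex.I * ρ * ∫ θ in (0 : ℝ)..Real.pi, g θ * Real.sin θ *
        Complex.exp (Complex.I * (ρ * Real.cos θ)) =
      g 0 * Complex.exp (Complex.I * ρ) - g Real.pi * Complex.exp (-(Complex.I * ρ)) +
        ∫ θ in (0 : ℝ)..Real.pi, g' θ * Complex.exp (Complex.I * (ρ * Real.cos θ)) := by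
  have cg : Continuous g := continuous_iff_continuousAt.2 fun x => (hg x).continuousAt
  have hE : ∀ θ : ℝ, HasDerivAt (fun θ : ℝ => Complex.exp (Complex.I * (ρ * (Real.cos θ : ℂ))))
      (-(Complex.I * ρ * Real.sin θ * Complex.exp (Complex.I * (ρ * (Real.cos θ : ℂ))))) θ :=
    fun θ => by
      convert! ((((Real.hasDerivAt_cos θ).ofReal_comp).const_mul (ρ : ℂ)).const_mul
        Complex.I).cexp using 1
      push_cast; ring
  have key := integral_mul_deriv_eq_deriv_mul (a := 0) (b := Real.pi) (fun θ _ => hg θ)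
    (fun θ _ => hE θ) (hg'.intervalIntegrable _ _)
    ((by fun_prop : Continuous _).intervalIntegrable _ _)
  rw [← intervalIntegral.integral_const_mul]
  have e : ∀ θ : ℝ, Complex.I * ρ * (g θ * Real.sin θ *
      Complex.exp (Complex.I * (ρ * Real.cos θ))) =
      -(g θ * -(Complex.I * ρ * Real.sin θ * Complex.exp (Complex.I * (ρ * (Real.cos θ : ℂ))))) :=
    fun θ => by ring
  simp_rw [e]
  rw [intervalIntegral.integral_neg, key]
  simp
  ring

theorem hasDerivAt_mul_sin_pow (c : ℂ) (n : ℕ) (θ : ℝ) :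
    HasDerivAt (fun θ : ℝ => (1 + c * (Real.cos θ : ℂ)) * ((Real.sin θ ^ n : ℝ) : ℂ))
      (-(c * Real.sin θ) * ((Real.sin θ ^ n : ℝ) : ℂ) + (1 + c * (Real.cos θ : ℂ)) *
        ((n * Real.sin θ ^ (n - 1) * Real.cos θ : ℝ) : ℂ)) θ := by
  have h1 := (((Real.hasDerivAt_cos θ).ofReal_comp).const_mul c).const_add 1
  have h2 := ((Real.hasDerivAt_sin θ).pow n).ofReal_comp
  convert! h1.mul h2 using 1
  simp only [Pi.pow_apply]
  push_cast; ring

/-- One factor of sin is spent on an integration by parts, gaining 1/ρ. The boundary terms vanish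
because a positive power of sin remains, and the new integral is O(ρ^{-1/2}). -/
theorem norm_sphereTransform_add_two_le (n : ℕ) :
    ∃ C, 0 ≤ C ∧ ∀ ρ : ℝ, 0 < ρ → ‖sphereTransform (n + 2) ρ‖ ≤ C / (ρ * √ρ) := by
  have hd : ∀ θ : ℝ, HasDerivAt (fun θ : ℝ => ((Real.sin θ ^ (n + 1) : ℝ) : ℂ))
      (((n + 1) * Real.sin θ ^ n * Real.cos θ : ℝ) : ℂ) θ := fun θ => by
    have := ((Real.hasDerivAt_sin θ).pow (n + 1)).ofReal_comp
    convert! this using 1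
    push_cast; simp
  have hd2 : ∀ θ : ℝ, HasDerivAt (fun θ : ℝ => (((n + 1) * Real.sin θ ^ n * Real.cos θ : ℝ) : ℂ))
      (((n + 1) * (n * Real.sin θ ^ (n - 1) * Real.cos θ) * Real.cos θ +
        (n + 1) * Real.sin θ ^ n * (-Real.sin θ) : ℝ) : ℂ) θ := fun θ =>
    ((((Real.hasDerivAt_sin θ).pow n).const_mul ((n : ℝ) + 1)).mul
      (Real.hasDerivAt_cos θ)).ofReal_comp
  obtain ⟨C, hC, h⟩ := norm_integral_mul_exp_cos_le hd2 (by fun_prop)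
  refine ⟨C, hC, fun ρ hρ => ?_⟩
  have key := integral_mul_sin_mul_exp_cos hd (by fun_prop) ρ
  have e : sphereTransform (n + 2) ρ = ∫ θ in (0 : ℝ)..Real.pi,
      ((Real.sin θ ^ (n + 1) : ℝ) : ℂ) * Real.sin θ *
        Complex.exp (Complex.I * (ρ * Real.cos θ)) := by
    unfold sphereTransform
    congr 1; ext θ; push_cast; ring
  rw [← e] at key
  simp only [Real.sin_zero, Real.sin_pi, ne_eq, Nat.add_eq_zero_iff, one_ne_zero, and_false,
    not_false_eq_true, zero_pow, Complex.ofReal_zero, zero_mul, sub_zero, zero_add] at key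
  have h2 := h ρ hρ
  rw [← key, norm_mul, norm_mul, Complex.norm_I, Complex.norm_real, Real.norm_of_nonneg hρ.le,
    one_mul] at h2
  calc ‖sphereTransform (n + 2) ρ‖ ≤ C / √ρ / ρ := by
        rw [le_div_iff₀ hρ]; linarith
    _ = _ := by rw [div_div, mul_comm]

theorem norm_sphereTransform_le (n : ℕ) (ρ : ℝ) : ‖sphereTransform n ρ‖ ≤ 4 := by
  have := norm_integral_le_of_norm_le_const (a := 0) (b := Real.pi) (C := 1)
    (f := fun θ : ℝ => (Real.sin θ ^ n : ℝ) * Complex.exp (Complex.I * (ρ * Real.cos θ)))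
    fun θ _ => by
      rw [norm_mul, norm_exp_I_mul_ofReal_mul, mul_one, Complex.norm_real, norm_pow]
      exact pow_le_one₀ (norm_nonneg _) (Real.abs_sin_le_one θ)
  rw [sub_zero, abs_of_pos Real.pi_pos] at this
  exact this.trans (by linarith [Real.pi_lt_d2])

theorem continuous_sphereTransform (n : ℕ) : Continuous (sphereTransform n) := by
  unfold sphereTransform
  refine continuous_parametric_intervalIntegral_of_continuous' ?_ _ _
  fun_prop

/-- The coefficient of `e^{iρ}` in the Fourier transform of the sphere. -/
noncomputable def sphereAmplitude (n : ℕ) (ρ : ℝ) : ℂ :=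
  ∫ θ in (0 : ℝ)..Real.pi, (1 / 2 * ((1 + 1 * (Real.cos θ : ℂ)) * ((Real.sin θ ^ n : ℝ) : ℂ))) *
    Complex.exp (Complex.I * (ρ * (Real.cos θ - 1 : ℝ)))

theorem exp_mul_sphereAmplitude (n : ℕ) (ρ : ℝ) :
    Complex.exp (Complex.I * ρ) * sphereAmplitude n ρ = ∫ θ in (0 : ℝ)..Real.pi,
      (1 / 2 * ((1 + 1 * (Real.cos θ : ℂ)) * ((Real.sin θ ^ n : ℝ) : ℂ))) *
        Complex.exp (Complex.I * (ρ * Real.cos θ)) := by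
  unfold sphereAmplitude
  rw [← intervalIntegral.integral_const_mul]
  congr 1
  ext θ
  rw [mul_left_comm, ← Complex.exp_add]
  congr 2
  push_cast; ring

/-- Split 1 = (1 + cos θ)/2 + (1 - cos θ)/2. The first weight suppresses the stationary point π, the
second suppresses 0, and θ ↦ π - θ exchanges the two halves up to conjugation. -/
theorem sphereTransform_eq (n : ℕ) (ρ : ℝ) :
    sphereTransform n ρ = sphereAmplitude n ρ * Complex.exp (Complex.I * ρ) +
      (starRingEnd ℂ) (sphereAmplitude n ρ * Complex.exp (Complex.I * ρ)) := by
  rw [mul_comm (sphereAmplitude n ρ), exp_mul_sphereAmplitude, ← intervalIntegral_conj]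
  have h := integral_comp_sub_left (a := 0) (b := Real.pi) (fun θ : ℝ => (starRingEnd ℂ)
    ((1 / 2 * ((1 + 1 * (Real.cos θ : ℂ)) * ((Real.sin θ ^ n : ℝ) : ℂ))) *
      Complex.exp (Complex.I * (ρ * Real.cos θ)))) Real.pi
  rw [sub_self, sub_zero] at h
  rw [← h, ← intervalIntegral.integral_add ((by fun_prop : Continuous _).intervalIntegrable _ _)
    ((by fun_prop : Continuous _).intervalIntegrable _ _)]
  unfold sphereTransform
  congr 1
  ext θ
  rw [Real.sin_pi_sub, Real.cos_pi_sub, map_mul, ← Complex.exp_conj]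
  simp only [map_mul, map_add, map_div₀, map_one, Complex.conj_ofReal, Complex.conj_I, map_ofNat]
  push_cast
  rw [show -Complex.I * ((ρ : ℂ) * -Complex.cos θ) = Complex.I * (ρ * Complex.cos θ) by ring]
  ring

/-- Differentiation produces (cos θ - 1)(1 + cos θ) = -sin²θ, so the derivative is again a sphere
transform, two dimensions higher. This choice of weight gives the decay of A' without an asymptotic
expansion. -/
theorem hasDerivAt_sphereAmplitude (n : ℕ) (ρ : ℝ) :
    HasDerivAt (sphereAmplitude n)
      (-(Complex.I / 2) * Complex.exp (-(Complex.I * ρ)) * sphereTransform (n + 2) ρ) ρ := by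
  convert! hasDerivAt_integral_mul_exp (a := 0) (b := Real.pi)
    (g := fun θ : ℝ => 1 / 2 * ((1 + 1 * (Real.cos θ : ℂ)) * ((Real.sin θ ^ n : ℝ) : ℂ)))
    (h := fun θ => Real.cos θ - 1) (by fun_prop) (by fun_prop) ρ using 1
  unfold sphereTransform
  rw [← intervalIntegral.integral_const_mul]
  congr 1
  ext θ
  have e : Complex.exp (Complex.I * (ρ * (Real.cos θ - 1 : ℝ))) =
      Complex.exp (-(Complex.I * ρ)) * Complex.exp (Complex.I * (ρ * Real.cos θ)) := by
    rw [← Complex.exp_add]; congr 1; push_cast; ring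
  have h2 : (Complex.sin θ) ^ 2 = 1 - Complex.cos θ ^ 2 := by
    rw [← Complex.sin_sq_add_cos_sq (θ : ℂ)]; ring
  rw [e, pow_add]
  push_cast
  rw [h2]
  ring

theorem norm_integral_mul_sin_mul_exp_cos_le {g g' : ℝ → ℂ} (hg : ∀ θ, HasDerivAt g (g' θ) θ)
    (hg' : Continuous g') :
    ∃ C, 0 ≤ C ∧ ∀ ρ : ℝ, 0 < ρ → ‖∫ θ in (0 : ℝ)..Real.pi, g θ * Real.sin θ *
      Complex.exp (Complex.I * (ρ * Real.cos θ))‖ ≤ C / ρ := by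
  have n0 : 0 ≤ ∫ θ in (0 : ℝ)..Real.pi, ‖g' θ‖ :=
    integral_nonneg Real.pi_pos.le fun θ _ => norm_nonneg _
  refine ⟨‖g 0‖ + ‖g Real.pi‖ + ∫ θ in (0 : ℝ)..Real.pi, ‖g' θ‖, by positivity, fun ρ hρ => ?_⟩
  have key := congrArg norm (integral_mul_sin_mul_exp_cos hg hg' ρ)
  rw [norm_mul, norm_mul, Complex.norm_I, Complex.norm_real, Real.norm_of_nonneg hρ.le,
    one_mul] at key
  rw [le_div_iff₀ hρ, mul_comm, key]
  refine (norm_add_le _ _).trans (add_le_add ((norm_sub_le _ _).trans (le_of_eq ?_)) ?_)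
  · have e : Complex.exp (-(Complex.I * ρ)) = Complex.exp (Complex.I * ((-ρ : ℝ) : ℂ)) := by
      push_cast; ring_nf
    rw [norm_mul, norm_mul, e, norm_exp_I_mul, norm_exp_I_mul, mul_one, mul_one]
  · refine norm_integral_le_of_norm_le Real.pi_pos.le (Filter.Eventually.of_forall fun θ _ => ?_)
      (hg'.norm.intervalIntegrable _ _)
    rw [norm_mul, norm_exp_I_mul_ofReal_mul, mul_one]

theorem norm_sphereAmplitude_eq (n : ℕ) (ρ : ℝ) :
    ‖sphereAmplitude n ρ‖ = ‖∫ θ in (0 : ℝ)..Real.pi,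
      (1 / 2 * ((1 + 1 * (Real.cos θ : ℂ)) * ((Real.sin θ ^ n : ℝ) : ℂ))) *
        Complex.exp (Complex.I * (ρ * Real.cos θ))‖ := by
  rw [← exp_mul_sphereAmplitude, norm_mul, norm_exp_I_mul, one_mul]

theorem norm_sphereAmplitude_le (n : ℕ) (ρ : ℝ) : ‖sphereAmplitude n ρ‖ ≤ 4 := by
  rw [norm_sphereAmplitude_eq]
  have := norm_integral_le_of_norm_le_const (a := 0) (b := Real.pi) (C := 1)
    (f := fun θ : ℝ => (1 / 2 * ((1 + 1 * (Real.cos θ : ℂ)) * ((Real.sin θ ^ n : ℝ) : ℂ))) *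
      Complex.exp (Complex.I * (ρ * Real.cos θ))) fun θ _ => by
    have h1 : ‖(1 + 1 * (Real.cos θ : ℂ))‖ ≤ 2 := by
      refine (norm_add_le _ _).trans ?_
      rw [one_mul, Complex.norm_real, norm_one]
      linarith [Real.abs_cos_le_one θ, Real.norm_eq_abs (Real.cos θ)]
    have h2 : ‖((Real.sin θ ^ n : ℝ) : ℂ)‖ ≤ 1 := by
      rw [Complex.norm_real, norm_pow]
      exact pow_le_one₀ (norm_nonneg _) (Real.abs_sin_le_one θ)
    rw [norm_mul, norm_exp_I_mul_ofReal_mul, mul_one, norm_mul, norm_mul]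
    have h3 : ‖(1 / 2 : ℂ)‖ = 1 / 2 := by norm_num
    rw [h3]
    nlinarith [norm_nonneg (1 + 1 * (Real.cos θ : ℂ)), norm_nonneg ((Real.sin θ ^ n : ℝ) : ℂ)]
  rw [sub_zero, abs_of_pos Real.pi_pos] at this
  exact this.trans (by linarith [Real.pi_lt_d2])

/-- Van der Corput gives ρ^{-1/2} for A; if n ≥ 1 a factor of sin is available and integration by
parts gives 1/ρ. The derivative has half the size of `sphereTransform (n + 2)`, which is bounded for
ρ ≤ 1 and O(ρ^{-3/2}) for ρ ≥ 1. -/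
theorem exists_isBesselAmplitude_sphereAmplitude (n : ℕ) :
    ∃ K A', IsBesselAmplitude K (sphereAmplitude n) A' ∧
      (1 ≤ n → ∀ ρ, 0 < ρ → ‖sphereAmplitude n ρ‖ ≤ K / ρ) := by
  obtain ⟨C₁, hC₁, h₁⟩ := norm_sphereTransform_add_two_le n
  obtain ⟨C₂, hC₂, h₂⟩ := norm_integral_mul_exp_cos_le
    (fun θ => (hasDerivAt_mul_sin_pow 1 n θ).const_mul (1 / 2)) (by fun_prop)
  -- The truncated exponent n - 1 is harmless: this bound is used only for n ≥ 1.
  obtain ⟨C₃, hC₃, h₃⟩ := norm_integral_mul_sin_mul_exp_cos_le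
    (fun θ => (hasDerivAt_mul_sin_pow 1 (n - 1) θ).const_mul (1 / 2)) (by fun_prop)
  have c := continuous_sphereTransform (n + 2)
  refine ⟨12 + 3 * C₁ + C₂ + C₃, _, ⟨fun ρ => hasDerivAt_sphereAmplitude n ρ, by fun_prop,
    fun ρ _ => (norm_sphereAmplitude_le n ρ).trans (by linarith), fun ρ hρ => ?_,
    fun ρ hρ => ?_⟩, fun hn ρ hρ => ?_⟩
  · rw [norm_sphereAmplitude_eq]
    refine (h₂ ρ hρ).trans ?_
    gcongr
    linarith
  · have e : ‖-(Complex.I / 2) * Complex.exp (-(Complex.I * ρ)) * sphereTransform (n + 2) ρ‖ =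
        1 / 2 * ‖sphereTransform (n + 2) ρ‖ := by
      have e : Complex.exp (-(Complex.I * ρ)) = Complex.exp (Complex.I * ((-ρ : ℝ) : ℂ)) := by
        push_cast; ring_nf
      rw [norm_mul, norm_mul, e, norm_exp_I_mul]
      simp
    rw [e]
    have s0 : 0 < √(1 + ρ) := Real.sqrt_pos.2 (by linarith)
    rw [le_div_iff₀ (by positivity)]
    rcases le_total ρ 1 with h | h
    · have k1 : √(1 + ρ) ≤ 3 / 2 := Real.sqrt_le_iff.2 ⟨by norm_num, by linarith⟩
      have k2 : (1 + ρ) * √(1 + ρ) ≤ 3 := by nlinarith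
      have k3 := norm_sphereTransform_le (n + 2) ρ
      calc _ ≤ (1 / 2 * 4 * 3 : ℝ) := by gcongr
        _ ≤ _ := by linarith
    · have ρ0 : 0 < ρ := by linarith
      have r0 := Real.sqrt_pos.2 ρ0
      have k1 : √(1 + ρ) ≤ 3 / 2 * √ρ := by
        refine Real.sqrt_le_iff.2 ⟨by positivity, ?_⟩
        rw [mul_pow, Real.sq_sqrt ρ0.le]; linarith
      calc _ ≤ 1 / 2 * (C₁ / (ρ * √ρ)) * ((2 * ρ) * (3 / 2 * √ρ)) := by
            gcongr
            · exact h₁ ρ ρ0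
            · linarith
        _ = 3 / 2 * C₁ := by field_simp
        _ ≤ _ := by linarith
  · have h := h₃ ρ hρ
    rw [norm_sphereAmplitude_eq]
    calc _ = _ := by
          congr 2; ext θ
          rw [show Real.sin θ ^ n = Real.sin θ ^ (n - 1) * Real.sin θ by
            rw [← pow_succ, Nat.sub_add_cancel hn]]
          push_cast
          ring_nf
      _ ≤ C₃ / ρ := h
      _ ≤ _ := by gcongr; linarith

/-- As w is real, the two halves of the sphere transform contribute conjugate integrals, so the
estimate for A e^{iρ} suffices. -/
theorem exists_norm_radial_sphereTransform_le {w : ℝ → ℝ} {W : ℝ} {w' : ℝ → ℂ}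
    (hw : IsWeight W (fun r => (w r : ℂ)) w') (n : ℕ) {α : ℝ}
    (hα : (1 ≤ n ∧ α = 1) ∨ α = 5 / 6) :
    ∃ C, ∀ t s b : ℝ, 1 ≤ t → 0 ≤ b →
      ‖∫ r in (1 / 2 : ℝ)..2, (w r : ℂ) * sphereTransform n (t * radialPhase s b r)‖ ≤
        C * t ^ (-α) := by
  obtain ⟨K, A', hA, hA1⟩ := exists_isBesselAmplitude_sphereAmplitude n
  have hK := hA.nonneg
  have hW := hw.nonneg
  have cA := hA.continuous
  have cw := hw.continuous
  have main : ∀ t s b : ℝ, 1 ≤ t → 0 < b →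
      ‖∫ r in (1 / 2 : ℝ)..2, (w r : ℂ) * sphereAmplitude n (t * radialPhase s b r) *
        Complex.exp (Complex.I * (t * radialPhase s b r : ℝ))‖ ≤
        10 ^ 14 * (W * K * t ^ (-α)) := by
    intro t s b ht hb
    rcases hα with ⟨hn, rfl⟩ | rfl
    · refine (norm_radial_integral_le hA (hA1 hn) hw hb (by linarith)).trans ?_
      rw [Real.rpow_neg_one, ← div_eq_mul_inv]
      have : 0 ≤ W * K / t := by positivity
      nlinarith
    · exact norm_radial_integral_le_rpow hA hw hb ht
  have main' : ∀ t s b : ℝ, 1 ≤ t → 0 < b →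
      ‖∫ r in (1 / 2 : ℝ)..2, (w r : ℂ) * sphereTransform n (t * radialPhase s b r)‖ ≤
        2 * 10 ^ 14 * W * K * t ^ (-α) := by
    intro t s b ht hb
    have cp := continuous_radialPhase s b
    have e : ∀ r : ℝ, (w r : ℂ) * sphereTransform n (t * radialPhase s b r) =
        (w r : ℂ) * sphereAmplitude n (t * radialPhase s b r) *
          Complex.exp (Complex.I * (t * radialPhase s b r : ℝ)) + (starRingEnd ℂ) ((w r : ℂ) *
          sphereAmplitude n (t * radialPhase s b r) *
          Complex.exp (Complex.I * (t * radialPhase s b r : ℝ))) := fun r => by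
      rw [sphereTransform_eq]
      simp only [map_mul, Complex.conj_ofReal]
      ring
    simp_rw [e]
    rw [integral_add ((by fun_prop : Continuous _).intervalIntegrable _ _)
      ((by fun_prop : Continuous _).intervalIntegrable _ _), intervalIntegral_conj]
    refine (norm_add_le _ _).trans ?_
    rw [RCLike.norm_conj]
    linarith [main t s b ht hb]
  refine ⟨2 * 10 ^ 14 * W * K, fun t s b ht hb => ?_⟩
  have cΦ := continuous_sphereTransform n
  have cw2 : Continuous fun p : ℝ × ℝ => (w p.2 : ℂ) := cw.comp continuous_snd
  -- The phase is smooth only for b > 0; the case of a focus on the axis follows by letting b'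
  -- decrease to b.
  have cont : Continuous fun b =>
      ‖∫ r in (1 / 2 : ℝ)..2, (w r : ℂ) * sphereTransform n (t * radialPhase s b r)‖ := by
    refine (continuous_parametric_intervalIntegral_of_continuous' ?_ _ _).norm
    unfold radialPhase planarDist
    exact cw2.mul (by fun_prop)
  have : Filter.Tendsto (fun b =>
      ‖∫ r in (1 / 2 : ℝ)..2, (w r : ℂ) * sphereTransform n (t * radialPhase s b r)‖)
      (nhdsWithin b (Ioi b)) (nhds _) := (cont.tendsto b).mono_left nhdsWithin_le_nhds
  refine le_of_tendsto this ?_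
  filter_upwards [self_mem_nhdsWithin] with b' hb'
  exact main' t s b' ht (hb.trans_lt hb')

end

/-! ### Reduction of the oscillatory integral to the radius -/

section

open MeasureTheory Set

section sphere
variable {E : Type*} [NormedAddCommGroup E] [InnerProductSpace ℝ E] [FiniteDimensional ℝ E]
  [MeasurableSpace E] [BorelSpace E]

/-- The homeomorphism of the unit sphere induced by a linear isometry. -/
noncomputable def unitSphereHomeomorph (O : E ≃ₗᵢ[ℝ] E) :
    Metric.sphere (0 : E) 1 ≃ₜ Metric.sphere (0 : E) 1 :=
  O.toHomeomorph.subtype fun x => by simp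

omit [FiniteDimensional ℝ E] [MeasurableSpace E] [BorelSpace E] in
theorem coe_unitSphereHomeomorph (O : E ≃ₗᵢ[ℝ] E) (ω : Metric.sphere (0 : E) 1) :
    (unitSphereHomeomorph O ω : E) = O ω := rfl

-- The spherical measure of a set is a multiple of the volume of the cone over it, and a linear
-- isometry carries cones to cones and preserves volume.
open scoped Pointwise in
theorem measurePreserving_unitSphereHomeomorph (O : E ≃ₗᵢ[ℝ] E) :
    MeasurePreserving (unitSphereHomeomorph O) (volume : Measure E).toSphere
      (volume : Measure E).toSphere := by
  refine ⟨(unitSphereHomeomorph O).measurable, Measure.ext fun s hs => ?_⟩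
  rw [Measure.map_apply (unitSphereHomeomorph O).measurable hs,
    Measure.toSphere_apply' _ ((unitSphereHomeomorph O).measurable hs),
    Measure.toSphere_apply' _ hs]
  congr 1
  rw [← (O.measurePreserving).measure_preimage_emb O.toHomeomorph.measurableEmbedding
    (Ioo (0 : ℝ) 1 • (Subtype.val '' s))]
  congr 1
  ext y
  simp only [Set.mem_smul, mem_image, mem_preimage]
  constructor
  · rintro ⟨r, hr, _, ⟨ω, hω, rfl⟩, rfl⟩
    exact ⟨r, hr, _, ⟨_, hω, rfl⟩, by rw [coe_unitSphereHomeomorph, map_smul]⟩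
  · rintro ⟨r, hr, _, ⟨ω, hω, rfl⟩, h⟩
    refine ⟨r, hr, _, ⟨(unitSphereHomeomorph O).symm ω, by simpa using hω, rfl⟩, ?_⟩
    apply O.injective
    rw [← h, map_smul, ← coe_unitSphereHomeomorph, Homeomorph.apply_symm_apply]

theorem integral_eq_integral_sphere [Nontrivial E] {F : E → ℂ} (hF : Integrable F) :
    ∫ x, F x = ∫ r : Ioi (0 : ℝ), ∫ ω : Metric.sphere (0 : E) 1, F ((r : ℝ) • (ω : E))
      ∂(volume : Measure E).toSphere ∂Measure.volumeIoiPow (Module.finrank ℝ E - 1) := by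
  have mp := (volume : Measure E).measurePreserving_homeomorphUnitSphereProd
  have emb := (homeomorphUnitSphereProd E).measurableEmbedding
  set G : Metric.sphere (0 : E) 1 × Ioi (0 : ℝ) → ℂ := fun p => F ((p.2 : ℝ) • (p.1 : E)) with hG
  have hGF : ∀ x : ({0}ᶜ : Set E), G (homeomorphUnitSphereProd E x) = F x := fun x => by
    simp only [hG]
    rw [← homeomorphUnitSphereProd_symm_apply_coe, Homeomorph.symm_apply_apply]
  have e1 : ∫ x, F x = ∫ x : ({0}ᶜ : Set E), F x ∂(volume.comap Subtype.val) := by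
    rw [integral_subtype_comap (measurableSet_singleton _).compl F, restrict_compl_singleton]
  have iG : Integrable G ((volume : Measure E).toSphere.prod
      (Measure.volumeIoiPow (Module.finrank ℝ E - 1))) := by
    rw [← mp.integrable_comp_emb emb]
    have : G ∘ homeomorphUnitSphereProd E = fun x : ({0}ᶜ : Set E) => F x := funext hGF
    rw [this]
    have h2 := (integrableOn_iff_comap_subtypeVal (f := F) (μ := volume)
      (measurableSet_singleton (0 : E)).compl).1 hF.integrableOn
    exact h2
  rw [e1]
  simp_rw [← hGF]
  rw [mp.integral_comp emb, integral_prod_symm _ iG]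

/-- Rotating the frequency variable by an isometry depending on its length only does not change
the integral of a plane wave against a radial function. -/
theorem integral_radial_mul_exp_eq [Nontrivial E] {f : ℝ → ℂ} {V V' : ℝ → E}
    (hV : ∀ r, ‖V r‖ = ‖V' r‖)
    (h : Integrable fun ξ : E => f ‖ξ‖ * Complex.exp (Complex.I * (inner ℝ (V ‖ξ‖) ξ : ℝ)))
    (h' : Integrable fun ξ : E => f ‖ξ‖ * Complex.exp (Complex.I * (inner ℝ (V' ‖ξ‖) ξ : ℝ))) :
    ∫ ξ : E, f ‖ξ‖ * Complex.exp (Complex.I * (inner ℝ (V ‖ξ‖) ξ : ℝ)) =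
      ∫ ξ : E, f ‖ξ‖ * Complex.exp (Complex.I * (inner ℝ (V' ‖ξ‖) ξ : ℝ)) := by
  rw [integral_eq_integral_sphere h, integral_eq_integral_sphere h']
  congr 1
  ext r
  have nr : ∀ ω : Metric.sphere (0 : E) 1, ‖(r : ℝ) • (ω : E)‖ = r := fun ω => by
    rw [norm_smul, norm_eq_of_mem_sphere, mul_one, Real.norm_of_nonneg r.2.out.le]
  simp_rw [nr]
  -- Vectors of equal length are exchanged by the reflection in their perpendicular bisector, so no
  -- case distinction by dimension is needed.
  set O := (ℝ ∙ (V' r - V r))ᗮ.reflection with hO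
  have hOV : O (V' r) = V r := Submodule.reflection_sub (hV r).symm
  have := (measurePreserving_unitSphereHomeomorph O).integral_comp
    (unitSphereHomeomorph O).measurableEmbedding (fun ω => f r *
      Complex.exp (Complex.I * (inner ℝ (V r) ((r : ℝ) • (ω : E)) : ℝ)))
  rw [← this]
  congr 1
  ext ω
  rw [coe_unitSphereHomeomorph, ← map_smul, ← hOV, LinearIsometryEquiv.inner_map_map]

end sphere

/-- Splitting off the first coordinate of Euclidean space. -/
noncomputable def euclideanSplit (n : ℕ) :
    EuclideanSpace ℝ (Fin (n + 1)) ≃ᵐ ℝ × EuclideanSpace ℝ (Fin n) :=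
  ((MeasurableEquiv.toLp 2 (Fin (n + 1) → ℝ)).symm.trans
    (MeasurableEquiv.piFinSuccAbove (fun _ => ℝ) 0)).trans
      ((MeasurableEquiv.refl ℝ).prodCongr (MeasurableEquiv.toLp 2 (Fin n → ℝ)))

theorem measurePreserving_euclideanSplit (n : ℕ) : MeasurePreserving (euclideanSplit n) :=
  ((MeasurePreserving.id volume).prod (PiLp.volume_preserving_toLp (Fin n))).comp
    ((volume_preserving_piFinSuccAbove (fun _ => ℝ) 0).comp
      (EuclideanSpace.volume_preserving_symm_measurableEquiv_toLp _))

theorem euclideanSplit_fst (n : ℕ) (ξ : EuclideanSpace ℝ (Fin (n + 1))) :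
    (euclideanSplit n ξ).1 = ξ 0 := rfl

theorem norm_euclideanSplit (n : ℕ) (ξ : EuclideanSpace ℝ (Fin (n + 1))) :
    ‖ξ‖ = √((euclideanSplit n ξ).1 ^ 2 + ‖(euclideanSplit n ξ).2‖ ^ 2) := by
  rw [EuclideanSpace.norm_eq, EuclideanSpace.norm_eq, Real.sq_sqrt (by positivity),
    Fin.sum_univ_succ]
  simp only [Real.norm_eq_abs, sq_abs]
  rfl

/-- Cylindrical coordinates for a function of `|ξ|` and the first coordinate. -/
theorem integral_norm_fst_eq (n : ℕ) {G : ℝ → ℝ → ℂ} (cG : Continuous fun p : ℝ × ℝ => G p.1 p.2)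
    (hG : ∀ r, r ∉ Icc (1 / 2 : ℝ) 2 → ∀ u, G r u = 0) :
    ∫ ξ : EuclideanSpace ℝ (Fin (n + 2)), G ‖ξ‖ (ξ 0) =
      ((n + 1 : ℕ) * volume.real (Metric.ball (0 : EuclideanSpace ℝ (Fin (n + 1))) 1) : ℝ) *
        ∫ r in (1 / 2 : ℝ)..2, (r ^ (n + 1) : ℝ) *
          ∫ θ in (0 : ℝ)..Real.pi, (Real.sin θ ^ n : ℝ) * G r (r * Real.cos θ) := by
  set c : ℝ := (n + 1 : ℕ) * volume.real (Metric.ball (0 : EuclideanSpace ℝ (Fin (n + 1))) 1)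
  have big : ∀ {F : Type} [NormedAddCommGroup F] [ProperSpace F] (φ : ℝ × F → ℂ),
      Continuous φ → (∀ p, 2 < √(p.1 ^ 2 + ‖p.2‖ ^ 2) → φ p = 0) → HasCompactSupport φ := by
    intro F _ _ φ _ h
    refine HasCompactSupport.of_support_subset_isCompact
      (isCompact_closedBall (0 : ℝ × F) 2) fun p hp => ?_
    rw [mem_closedBall_zero_iff, Prod.norm_def]
    by_contra hlt
    refine hp (h p ?_)
    rw [not_le, lt_max_iff] at hlt
    refine Real.lt_sqrt_of_sq_lt ?_
    rcases hlt with h1 | h1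
    · have : 2 ^ 2 < ‖p.1‖ ^ 2 := pow_lt_pow_left₀ h1 (by norm_num) two_ne_zero
      rw [Real.norm_eq_abs, sq_abs] at this
      nlinarith [sq_nonneg ‖p.2‖]
    · nlinarith [sq_nonneg p.1]
  have hG' : ∀ r, 2 < r → ∀ u, G r u = 0 := fun r hr => hG r fun h => absurd h.2 (not_le.2 hr)
  have e1 : ∫ ξ : EuclideanSpace ℝ (Fin (n + 2)), G ‖ξ‖ (ξ 0) =
      ∫ p : ℝ × EuclideanSpace ℝ (Fin (n + 1)), G (√(p.1 ^ 2 + ‖p.2‖ ^ 2)) p.1 := by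
    rw [← (measurePreserving_euclideanSplit (n + 1)).integral_comp']
    simp_rw [← norm_euclideanSplit, euclideanSplit_fst]
  have c1 : Continuous fun p : ℝ × EuclideanSpace ℝ (Fin (n + 1)) =>
      G (√(p.1 ^ 2 + ‖p.2‖ ^ 2)) p.1 :=
    cG.comp (by fun_prop : Continuous fun p : ℝ × EuclideanSpace ℝ (Fin (n + 1)) =>
      (√(p.1 ^ 2 + ‖p.2‖ ^ 2), p.1))
  have i1 := c1.integrable_of_hasCompactSupport (μ := volume) (big _ c1 fun p hp => hG' _ hp _)
  -- After the directions in ℝ^(n+1) are integrated out, q = |ξ'| carries the weight q^n on q > 0.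
  -- Polar coordinates in (u, q) then give r (r sin θ)^n with 0 < θ < π.
  set Q : ℝ × ℝ → ℂ := fun p => (p.2 ^ n : ℝ) * G (√(p.1 ^ 2 + p.2 ^ 2)) p.1 with hQ
  have cQ : Continuous Q := by
    have := cG.comp (by fun_prop : Continuous fun p : ℝ × ℝ => (√(p.1 ^ 2 + p.2 ^ 2), p.1))
    simp only [Function.comp_def] at this
    fun_prop
  have iQ := cQ.integrable_of_hasCompactSupport (μ := volume) (big _ cQ fun p hp => by
    rw [Real.norm_eq_abs, sq_abs] at hp
    simp only [hQ, hG' _ hp, mul_zero])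
  have iQ' : Integrable ((univ ×ˢ Ioi (0 : ℝ)).indicator Q) :=
    iQ.indicator (MeasurableSet.univ.prod measurableSet_Ioi)
  have e2 : ∫ p : ℝ × EuclideanSpace ℝ (Fin (n + 1)), G (√(p.1 ^ 2 + ‖p.2‖ ^ 2)) p.1 =
      c * ∫ p : ℝ × ℝ, (univ ×ˢ Ioi (0 : ℝ)).indicator Q p := by
    rw [Measure.volume_eq_prod] at i1 iQ' ⊢
    rw [integral_prod _ i1, Measure.volume_eq_prod, integral_prod _ iQ', ← integral_const_mul]
    congr 1
    ext u
    have h1 := integral_fun_norm_addHaar (volume : Measure (EuclideanSpace ℝ (Fin (n + 1))))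
      (fun q => G (√(u ^ 2 + q ^ 2)) u)
    simp only [finrank_euclideanSpace, Fintype.card_fin, Nat.add_sub_cancel] at h1
    rw [h1]
    have h2 : ∀ q, (univ ×ˢ Ioi (0 : ℝ)).indicator Q (u, q) =
        (Ioi (0 : ℝ)).indicator (fun q => q ^ n • G (√(u ^ 2 + q ^ 2)) u) q := fun q => by
      by_cases hq : 0 < q <;> simp [indicator, hq, hQ]
    simp_rw [h2]
    rw [integral_indicator measurableSet_Ioi]
    simp only [c, nsmul_eq_mul, Complex.real_smul]
    push_cast; ring
  have e3 : ∫ p : ℝ × ℝ, (univ ×ˢ Ioi (0 : ℝ)).indicator Q p =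
      ∫ p in Icc (1 / 2 : ℝ) 2 ×ˢ Icc 0 Real.pi,
        (p.1 ^ (n + 1) : ℝ) * ((Real.sin p.2 ^ n : ℝ) * G p.1 (p.1 * Real.cos p.2)) := by
    have hsub : Icc (1 / 2 : ℝ) 2 ×ˢ Ioo 0 Real.pi ⊆ polarCoord.target := by
      rw [polarCoord_target]
      exact prod_mono (fun r hr => lt_of_lt_of_le (by norm_num) hr.1)
        (Ioo_subset_Ioo_left (neg_nonpos.2 Real.pi_pos.le))
    have hval : ∀ p ∈ polarCoord.target, p.1 • (univ ×ˢ Ioi (0 : ℝ)).indicator Q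
        (polarCoord.symm p) = if 0 < p.2 then (p.1 ^ (n + 1) : ℝ) *
          ((Real.sin p.2 ^ n : ℝ) * G p.1 (p.1 * Real.cos p.2)) else 0 := by
      rintro ⟨r, θ⟩ hp
      rw [polarCoord_target] at hp
      have hr : 0 < r := hp.1
      have hθ : θ ∈ Ioo (-Real.pi) Real.pi := hp.2
      simp only [polarCoord_symm_apply]
      split_ifs with h
      · have hs : 0 < Real.sin θ := Real.sin_pos_of_pos_of_lt_pi h hθ.2
        rw [indicator_of_mem (show (r * Real.cos θ, r * Real.sin θ) ∈ univ ×ˢ Ioi (0 : ℝ) from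
          ⟨trivial, mul_pos hr hs⟩)]
        have e : √((r * Real.cos θ) ^ 2 + (r * Real.sin θ) ^ 2) = r := by
          rw [show (r * Real.cos θ) ^ 2 + (r * Real.sin θ) ^ 2 =
            r ^ 2 * (Real.sin θ ^ 2 + Real.cos θ ^ 2) by ring, Real.sin_sq_add_cos_sq, mul_one,
            Real.sqrt_sq hr.le]
        simp only [hQ, e, Complex.real_smul]
        push_cast; ring
      · have hs : Real.sin θ ≤ 0 :=
          Real.sin_nonpos_of_nonpos_of_neg_pi_le (not_lt.1 h) hθ.1.le
        rw [indicator_of_notMem, smul_zero]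
        exact fun h => absurd h.2 (not_lt.2 (mul_nonpos_of_nonneg_of_nonpos hr.le hs))
    have hae : (Icc (1 / 2 : ℝ) 2 ×ˢ Ioo 0 Real.pi : Set (ℝ × ℝ)) =ᵐ[volume]
        (Icc (1 / 2 : ℝ) 2 ×ˢ Icc 0 Real.pi : Set (ℝ × ℝ)) :=
      Measure.set_prod_ae_eq (Filter.EventuallyEq.refl _ _) Ioo_ae_eq_Icc
    rw [← integral_comp_polarCoord_symm, ← setIntegral_congr_set hae,
      setIntegral_eq_of_subset_of_forall_sdiff_eq_zero polarCoord.open_target.measurableSet hsub]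
    · refine setIntegral_congr_fun (measurableSet_Icc.prod measurableSet_Ioo) fun p hp => ?_
      rw [hval p (hsub hp), if_pos hp.2.1]
    · rintro p ⟨hp, hp'⟩
      rw [hval p hp]
      split_ifs with h
      · rw [hG p.1 fun hr => hp' ⟨hr, h, ?_⟩, mul_zero, mul_zero]
        rw [polarCoord_target] at hp
        exact hp.2.2
      · rfl
  rw [e1, e2, e3, Measure.volume_eq_prod, setIntegral_prod]
  · rw [intervalIntegral.integral_of_le (by norm_num), integral_Icc_eq_integral_Ioc]
    congr 2
    ext r
    rw [intervalIntegral.integral_of_le Real.pi_pos.le, integral_Icc_eq_integral_Ioc,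
      ← integral_const_mul]
  · refine ContinuousOn.integrableOn_compact (isCompact_Icc.prod isCompact_Icc) ?_
    have := cG.comp (by fun_prop : Continuous fun p : ℝ × ℝ => (p.1, p.1 * Real.cos p.2))
    simp only [Function.comp_def] at this
    exact Continuous.continuousOn (by fun_prop)

theorem integrable_radial_mul_exp {E : Type*} [NormedAddCommGroup E] [InnerProductSpace ℝ E]
    [FiniteDimensional ℝ E] [MeasurableSpace E] [BorelSpace E] {ψ : ℝ → ℝ} (cψ : Continuous ψ)
    (hψ : ∀ r, r ∉ Icc (1 / 2 : ℝ) 2 → ψ r = 0) {φ : E → ℝ} (hφ : Continuous φ) :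
    Integrable fun ξ : E => ((ψ ‖ξ‖ : ℝ) : ℂ) * Complex.exp (Complex.I * (φ ξ : ℝ)) := by
  refine Continuous.integrable_of_hasCompactSupport (by fun_prop)
    (HasCompactSupport.of_support_subset_isCompact
      (isCompact_closedBall (0 : E) 2) fun ξ hξ => ?_)
  rw [mem_closedBall_zero_iff]
  by_contra h
  refine hξ ?_
  dsimp only
  rw [hψ _ fun h' => h h'.2, Complex.ofReal_zero, zero_mul]

theorem inner_single_zero_one (n : ℕ) (y : EuclideanSpace ℝ (Fin (n + 1))) :
    inner ℝ (EuclideanSpace.single 0 1 : EuclideanSpace ℝ (Fin (n + 1))) y = y 0 := by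
  rw [EuclideanSpace.inner_single_left]; simp

/-- The phase is the inner product of ξ with t|ξ|e₁ + x, a vector depending on ξ only through its
length. It may therefore be rotated to a multiple of e₁ on each sphere. -/
theorem oscIntegral_eq_integral_norm (n : ℕ) (hd : 0 < n + 2) {ψ : ℝ → ℝ} (cψ : Continuous ψ)
    (hψ : ∀ r, r ∉ Icc (1 / 2 : ℝ) 2 → ψ r = 0) (t : ℝ)
    (x : EuclideanSpace ℝ (Fin (n + 2))) :
    oscIntegral hd ψ t x = ∫ ξ : EuclideanSpace ℝ (Fin (n + 2)), ((ψ ‖ξ‖ : ℝ) : ℂ) *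
      Complex.exp (Complex.I *
        (‖(t * ‖ξ‖) • (EuclideanSpace.single 0 1 : EuclideanSpace ℝ (Fin (n + 2))) + x‖ * ξ 0 :
          ℝ)) := by
  have key := integral_radial_mul_exp_eq (E := EuclideanSpace ℝ (Fin (n + 2)))
    (f := fun r => ((ψ r : ℝ) : ℂ))
    (V := fun r => (t * r) • (EuclideanSpace.single 0 1 : EuclideanSpace ℝ (Fin (n + 2))) + x)
    (V' := fun r => ‖(t * r) • (EuclideanSpace.single 0 1 : EuclideanSpace ℝ (Fin (n + 2))) + x‖ •
      (EuclideanSpace.single 0 1 : EuclideanSpace ℝ (Fin (n + 2))))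
    (fun r => by rw [norm_smul, norm_norm, PiLp.norm_single, norm_one, mul_one])
    (integrable_radial_mul_exp cψ hψ (by fun_prop)) (integrable_radial_mul_exp cψ hψ (by fun_prop))
  simp only [inner_add_left, real_inner_smul_left, inner_single_zero_one] at key
  rw [← key]
  unfold oscIntegral
  congr 1
  ext ξ
  congr 4
  change t * ξ 0 * ‖ξ‖ + _ = _
  ring

theorem norm_smul_single_add_eq (n : ℕ) {t : ℝ} (ht : 0 < t) (r : ℝ)
    (x : EuclideanSpace ℝ (Fin (n + 1))) :
    ‖(t * r) • (EuclideanSpace.single 0 1 : EuclideanSpace ℝ (Fin (n + 1))) + x‖ =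
      t * planarDist (-(x 0) / t)
        (‖x - x 0 • (EuclideanSpace.single 0 1 : EuclideanSpace ℝ (Fin (n + 1)))‖ / t) r := by
  set e₁ : EuclideanSpace ℝ (Fin (n + 1)) := EuclideanSpace.single 0 1 with he₁
  have in₁ : ∀ y, inner ℝ e₁ y = y 0 := inner_single_zero_one n
  have ne₁ : ‖e₁‖ = 1 := by rw [he₁, PiLp.norm_single, norm_one]
  have h1 : (t * r) • e₁ + x = (t * r + x 0) • e₁ + (x - x 0 • e₁) := by
    rw [add_smul]; abel
  have h2 : ‖(t * r) • e₁ + x‖ ^ 2 = (t * r + x 0) ^ 2 + ‖x - x 0 • e₁‖ ^ 2 := by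
    rw [h1, norm_add_sq_real, real_inner_smul_left, inner_sub_right, real_inner_smul_right,
      real_inner_self_eq_norm_sq, in₁, norm_smul, ne₁, Real.norm_eq_abs, mul_one, sq_abs]
    ring
  rw [planarDist, ← Real.sqrt_sq (norm_nonneg ((t * r) • e₁ + x)), h2]
  nth_rewrite 2 [← Real.sqrt_sq ht.le]
  rw [← Real.sqrt_mul (by positivity)]
  congr 1
  field_simp
  ring

/-- The oscillatory integral as a one-dimensional integral over the radius. -/
theorem oscIntegral_eq_radial_integral (n : ℕ) (hd : 0 < n + 2) {ψ : ℝ → ℝ} (cψ : Continuous ψ)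
    (hψ : ∀ r, r ∉ Icc (1 / 2 : ℝ) 2 → ψ r = 0) {t : ℝ} (ht : 0 < t)
    (x : EuclideanSpace ℝ (Fin (n + 2))) :
    ∃ s b : ℝ, 0 ≤ b ∧ oscIntegral hd ψ t x =
      ((n + 1 : ℕ) * volume.real (Metric.ball (0 : EuclideanSpace ℝ (Fin (n + 1))) 1) : ℝ) *
        ∫ r in (1 / 2 : ℝ)..2, ((r ^ (n + 1) * ψ r : ℝ) : ℂ) *
          sphereTransform n (t * radialPhase s b r) := by
  refine ⟨-(x 0) / t,
    ‖x - x 0 • (EuclideanSpace.single 0 1 : EuclideanSpace ℝ (Fin (n + 2)))‖ / t,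
    by positivity, ?_⟩
  rw [oscIntegral_eq_integral_norm n hd cψ hψ]
  simp_rw [norm_smul_single_add_eq (n + 1) ht]
  generalize -(x 0) / t = s
  generalize ‖x - x 0 • (EuclideanSpace.single 0 1 : EuclideanSpace ℝ (Fin (n + 2)))‖ / t = b
  have cD : Continuous (planarDist s b) := by unfold planarDist; fun_prop
  rw [integral_norm_fst_eq n
    (G := fun r u => (ψ r : ℂ) * Complex.exp (Complex.I * (t * planarDist s b r * u : ℝ)))
    (by fun_prop) (fun r hr u => by rw [hψ r hr]; simp)]
  congr 2
  ext r
  unfold sphereTransform radialPhase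
  rw [← intervalIntegral.integral_const_mul, ← intervalIntegral.integral_const_mul]
  congr 1
  ext θ
  push_cast
  rw [show (t : ℂ) * planarDist s b r * (r * Complex.cos θ) =
    t * (r * planarDist s b r) * Complex.cos θ by ring]
  ring

/-! ### The upper bound -/

theorem eq_zero_of_notMem_of_tsupport_subset {ψ : ℝ → ℝ} {s : Set ℝ} (h : tsupport ψ ⊆ s) (r : ℝ)
    (hr : r ∉ s) : ψ r = 0 :=
  image_eq_zero_of_notMem_tsupport fun h' => hr (h h')

/-- Changing the sign of `t` amounts to changing the sign of `x`. -/
theorem oscIntegral_neg {d : ℕ} (hd : 0 < d) (ψ : ℝ → ℝ) (t : ℝ) (x : EuclideanSpace ℝ (Fin d)) :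
    oscIntegral hd ψ (-t) x = oscIntegral hd ψ t (-x) := by
  unfold oscIntegral
  rw [← integral_neg_eq_self]
  congr 1
  ext ξ
  rw [norm_neg, inner_neg_right, inner_neg_left, PiLp.neg_apply, neg_mul_neg]

theorem exists_isWeight (ψ : SchwartzMap ℝ ℝ) (n : ℕ) :
    ∃ W w', IsWeight W (fun r => ((r ^ (n + 1) * ψ r : ℝ) : ℂ)) w' := by
  have hd : ∀ r : ℝ, HasDerivAt (fun r => ((r ^ (n + 1) * ψ r : ℝ) : ℂ))
      ((((n + 1 : ℕ) * r ^ n) * ψ r + r ^ (n + 1) * deriv ψ r : ℝ) : ℂ) r := fun r => by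
    have h1 := ((hasDerivAt_pow (n + 1) r).mul (ψ.differentiableAt (x := r)).hasDerivAt).ofReal_comp
    simpa using h1
  have cd : Continuous (deriv ψ) := (ψ.smooth 1).continuous_deriv le_rfl
  have cψ := ψ.continuous
  set w : ℝ → ℂ := fun r => ((r ^ (n + 1) * ψ r : ℝ) : ℂ) with hw
  set w' : ℝ → ℂ := fun r =>
    ((((n + 1 : ℕ) * r ^ n) * ψ r + r ^ (n + 1) * deriv ψ r : ℝ) : ℂ) with hw'
  have cw : Continuous w := by fun_prop
  have cw' : Continuous w' := by fun_prop
  obtain ⟨W₁, h₁⟩ := (isCompact_Icc (a := (1 / 2 : ℝ)) (b := 2)).exists_bound_of_continuousOn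
    cw.continuousOn
  obtain ⟨W₂, h₂⟩ := (isCompact_Icc (a := (1 / 2 : ℝ)) (b := 2)).exists_bound_of_continuousOn
    cw'.continuousOn
  exact ⟨max W₁ W₂, w', hd, cw', fun r hr => (h₁ r hr).trans (le_max_left _ _),
    fun r hr => (h₂ r hr).trans (le_max_right _ _)⟩

theorem norm_oscIntegral_le {d : ℕ} (hd : 0 < d) (ψ : ℝ → ℝ) (t : ℝ)
    (x : EuclideanSpace ℝ (Fin d)) :
    ‖oscIntegral hd ψ t x‖ ≤ ∫ ξ : EuclideanSpace ℝ (Fin d), |ψ ‖ξ‖| := by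
  refine (norm_integral_le_integral_norm _).trans (le_of_eq ?_)
  congr 1
  ext ξ
  rw [norm_mul, norm_exp_I_mul, mul_one, Complex.norm_real, Real.norm_eq_abs]

/-- The radial formula treats t ≥ 1. For 0 < t ≤ 1 the factor t^(-α) is at least 1 and the L¹ norm
of the integrand suffices; negative t follows by symmetry. -/
theorem decaysAtRate_of_le (n : ℕ) (hd : 0 < n + 2) (ψ : SchwartzMap ℝ ℝ)
    (hψ : tsupport ψ ⊆ Icc (1 / 2) 2) {α : ℝ} (hα : (1 ≤ n ∧ α = 1) ∨ α = 5 / 6) :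
    DecaysAtRate hd ψ α := by
  obtain ⟨W, w', hw⟩ := exists_isWeight ψ n
  obtain ⟨C, hC⟩ := exists_norm_radial_sphereTransform_le hw n hα
  have hα0 : 0 ≤ α := by rcases hα with ⟨_, rfl⟩ | rfl <;> norm_num
  set c : ℝ := (n + 1 : ℕ) * volume.real (Metric.ball (0 : EuclideanSpace ℝ (Fin (n + 1))) 1)
    with hc
  set M : ℝ := ∫ ξ : EuclideanSpace ℝ (Fin (n + 2)), |ψ ‖ξ‖|
  have hM : 0 ≤ M := integral_nonneg fun _ => abs_nonneg _
  have pos : ∀ t : ℝ, 0 < t → ∀ x, ‖oscIntegral hd ψ t x‖ ≤ (|c| * |C| + M) * t ^ (-α) := by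
    intro t ht x
    have t0 : 0 ≤ t ^ (-α) := by positivity
    rcases le_total 1 t with h | h
    · obtain ⟨s, b, hb, e⟩ := oscIntegral_eq_radial_integral n hd ψ.continuous
        (eq_zero_of_notMem_of_tsupport_subset hψ) ht x
      rw [e, norm_mul, Complex.norm_real, Real.norm_eq_abs]
      calc _ ≤ |c| * (|C| * t ^ (-α)) := by
            gcongr
            exact (hC t s b h hb).trans (mul_le_mul_of_nonneg_right (le_abs_self C) t0)
        _ ≤ _ := by nlinarith
    · refine (norm_oscIntegral_le hd ψ t x).trans ?_
      have h1 : 1 ≤ t ^ (-α) := Real.one_le_rpow_of_pos_of_le_one_of_nonpos ht h (by linarith)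
      have h2 : 0 ≤ |c| * |C| := by positivity
      change M ≤ _
      nlinarith
  refine ⟨|c| * |C| + M, fun t ht x => ?_⟩
  rcases lt_or_gt_of_ne ht with h | h
  · rw [abs_of_neg h, ← neg_neg t, oscIntegral_neg, neg_neg]
    exact pos (-t) (by linarith) (-x)
  · rw [abs_of_pos h]
    exact pos t h x

/-! ### Lower bounds by testing against bumps -/

section test
variable {E : Type*} [NormedAddCommGroup E] [InnerProductSpace ℝ E] [FiniteDimensional ℝ E]
  [MeasurableSpace E] [BorelSpace E]

open scoped FourierTransform in
variable (E) in
/-- A bump function that is a superposition of plane waves with integrable coefficients. -/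
theorem exists_bump_eq_integral_exp : ∃ (B : E → ℝ) (k : E → ℂ), Continuous B ∧ Integrable k ∧
    (∀ v, 0 ≤ B v) ∧ (∀ v, ‖v‖ ≤ 1 / 2 → B v = 1) ∧ (∀ v, 1 < ‖v‖ → B v = 0) ∧
    ∀ v, (B v : ℂ) = ∫ y, k y * Complex.exp (Complex.I * (inner ℝ ((2 * Real.pi) • y) v : ℝ)) := by
  -- The coefficients are the Fourier transform of a smooth bump of compact support, hence Schwartz
  -- and integrable; the superposition is Fourier inversion.
  let b : ContDiffBump (0 : E) := ⟨1 / 2, 1, by norm_num, by norm_num⟩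
  have h1 : HasCompactSupport (fun v => (b v : ℂ)) :=
    b.hasCompactSupport.comp_left Complex.ofReal_zero
  have h2 : ContDiff ℝ ((⊤ : ℕ∞) : WithTop ℕ∞) (fun v => (b v : ℂ)) :=
    Complex.ofRealCLM.contDiff.comp b.contDiff
  set f : SchwartzMap E ℂ := h1.toSchwartzMap h2
  have ik : Integrable (𝓕 f : SchwartzMap E ℂ) := (𝓕 f).integrable
  refine ⟨b, ((𝓕 f : SchwartzMap E ℂ) : E → ℂ), b.continuous, ik, fun v => b.nonneg, fun v hv => ?_, fun v hv => ?_, fun v => ?_⟩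
  · exact b.one_of_mem_closedBall (mem_closedBall_zero_iff.2 hv)
  · exact b.zero_of_le_dist (by rw [dist_zero_right]; exact hv.le)
  · have e := f.continuous.fourierInv_fourier_eq f.integrable ik
    have e2 : (b v : ℂ) = f v := rfl
    rw [e2, ← congrFun e v, Real.fourierInv_eq]
    congr 1
    ext y
    rw [Circle.smul_def, Real.fourierChar_apply, smul_eq_mul, mul_comm, real_inner_smul_left,
      mul_comm (_ : ℂ) Complex.I]
    rfl

/-- Each plane wave composed with ξ ↦ Lξ - c is a unimodular constant times a plane wave of
frequency L*(2πy). By Fubini the y-th wave contributes at most M|k(y)|, whatever L and c are. -/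
theorem norm_integral_mul_bump_le {B : E → ℝ} {k : E → ℂ} (hk : Integrable k)
    (hB : ∀ v, (B v : ℂ) =
      ∫ y, k y * Complex.exp (Complex.I * (inner ℝ ((2 * Real.pi) • y) v : ℝ)))
    {h : E → ℂ} (hh : Integrable h) {M : ℝ}
    (hM : ∀ x, ‖∫ ξ, h ξ * Complex.exp (Complex.I * (inner ℝ x ξ : ℝ))‖ ≤ M)
    (L : E →L[ℝ] E) (c : E) :
    ‖∫ ξ, h ξ * B (L ξ - c)‖ ≤ M * ∫ y, ‖k y‖ := by
  have e1 : ∀ ξ y : E, h ξ * (k y *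
      Complex.exp (Complex.I * (inner ℝ ((2 * Real.pi) • y) (L ξ - c) : ℝ))) =
      (k y * Complex.exp (Complex.I * (-inner ℝ ((2 * Real.pi) • y) c : ℝ))) *
      (h ξ * Complex.exp (Complex.I *
        (inner ℝ (L.adjoint ((2 * Real.pi) • y)) ξ : ℝ))) := fun ξ y => by
    rw [inner_sub_right, ContinuousLinearMap.adjoint_inner_left, sub_eq_add_neg,
      Complex.ofReal_add, mul_add, Complex.exp_add]
    ring
  have int : Integrable (fun p : E × E => h p.1 * (k p.2 *
      Complex.exp (Complex.I * (inner ℝ ((2 * Real.pi) • p.2) (L p.1 - c) : ℝ))))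
      (volume.prod volume) := by
    have i0 := hh.mul_prod hk
    refine (i0.mul_bdd (c := 1) (g := fun p : E × E => Complex.exp (Complex.I *
      (inner ℝ ((2 * Real.pi) • p.2) (L p.1 - c) : ℝ)))
      (by fun_prop : Continuous _).aestronglyMeasurable
      (Filter.Eventually.of_forall fun p => (norm_exp_I_mul _).le)).congr
      (Filter.Eventually.of_forall fun p => ?_)
    dsimp only
    ring
  simp_rw [hB, ← integral_const_mul]
  rw [integral_integral_swap int]
  simp_rw [e1, integral_const_mul]
  rw [← integral_const_mul]
  refine norm_integral_le_of_norm_le (hk.norm.const_mul M) (Filter.Eventually.of_forall fun y => ?_)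
  rw [norm_mul, norm_mul, norm_exp_I_mul, mul_one, mul_comm]
  exact mul_le_mul_of_nonneg_right (hM _) (norm_nonneg _)

end test

/-- If the amplitude has a fixed sign and the phase is nearly linear on the preimage of the unit
ball under an affine map, then some value of the oscillatory integral is comparable to the volume
of that preimage. -/
theorem exists_le_norm_oscIntegral {d : ℕ} (hd : 0 < d) {ψ : ℝ → ℝ} (cψ : Continuous ψ)
    (hψ : ∀ r, r ∉ Icc (1 / 2 : ℝ) 2 → ψ r = 0) :
    ∃ c₁ : ℝ, 0 < c₁ ∧ ∀ (a t σ γ : ℝ)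
      (L : EuclideanSpace ℝ (Fin d) →ₗ[ℝ] EuclideanSpace ℝ (Fin d))
      (c x₀ : EuclideanSpace ℝ (Fin d)), 0 < a → |σ| = 1 → LinearMap.det L ≠ 0 →
      (∀ ξ, ‖L ξ - c‖ ≤ 1 → a ≤ σ * ψ ‖ξ‖ ∧
        |t * ξ ⟨0, hd⟩ * ‖ξ‖ + inner ℝ x₀ ξ - γ| ≤ 1) →
      ∃ x, c₁ * a * |LinearMap.det L|⁻¹ ≤ ‖oscIntegral hd ψ t x‖ := by
  obtain ⟨B, k, cB, ik, B0, B1, Bs, hB⟩ :=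
    exists_bump_eq_integral_exp (EuclideanSpace ℝ (Fin d))
  set κ : ℝ := ∫ y, ‖k y‖ with hκ
  have κ0 : 0 ≤ κ := integral_nonneg fun _ => norm_nonneg _
  set v : ℝ := volume.real (Metric.closedBall (0 : EuclideanSpace ℝ (Fin d)) (1 / 2)) with hv
  have v0 : 0 < v := by
    rw [hv, measureReal_def]
    exact ENNReal.toReal_pos (Metric.measure_closedBall_pos _ _ (by norm_num)).ne'
      measure_closedBall_lt_top.ne
  -- Chosen so that m(κ + 1) is the lower bound (a/2)·volume, while the upper bound is mκ; the two
  -- conflict since m > 0.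
  refine ⟨v / (2 * (κ + 1)), by positivity, fun a t σ γ L c x₀ ha hσ hL hloc => ?_⟩
  by_contra hcon
  push Not at hcon
  set m : ℝ := v / (2 * (κ + 1)) * a * |LinearMap.det L|⁻¹ with hm
  have det0 : 0 < |LinearMap.det L|⁻¹ := inv_pos.2 (abs_pos.2 hL)
  have m0 : 0 < m := by positivity
  set h : EuclideanSpace ℝ (Fin d) → ℂ := fun ξ => (ψ ‖ξ‖ : ℂ) * Complex.exp (Complex.I *
    (t * ξ ⟨0, hd⟩ * ‖ξ‖ + inner ℝ x₀ ξ : ℝ)) with hh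
  have ih : Integrable h := integrable_radial_mul_exp cψ hψ (by fun_prop)
  have cL : Continuous L := L.continuous_of_finiteDimensional
  have upper : ‖∫ ξ, h ξ * B (L ξ - c)‖ ≤ m * κ := by
    refine norm_integral_mul_bump_le ik hB ih (fun x => ?_) (LinearMap.toContinuousLinearMap L) c
    have : (∫ ξ, h ξ * Complex.exp (Complex.I * (inner ℝ x ξ : ℝ))) =
        oscIntegral hd ψ t (x₀ + x) := by
      unfold oscIntegral
      congr 1
      ext ξ
      simp only [hh]
      rw [mul_assoc, ← Complex.exp_add, ← mul_add, ← Complex.ofReal_add, inner_add_left]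
      congr 4
      ring
    rw [this]
    exact (hcon _).le
  -- Removing the sign σ and the constant phase γ makes the real part nonnegative everywhere: on the
  -- support of the bump the remaining phase is at most 1 in size, so its cosine is at least 1/2.
  set F : EuclideanSpace ℝ (Fin d) → ℝ := fun ξ =>
    (σ * Complex.exp (Complex.I * (-γ : ℝ)) * (h ξ * B (L ξ - c))).re with hF
  have Feq : ∀ ξ, F ξ = σ * ψ ‖ξ‖ *
      Real.cos (t * ξ ⟨0, hd⟩ * ‖ξ‖ + inner ℝ x₀ ξ - γ) * B (L ξ - c) := fun ξ => by
    have e : (σ : ℂ) * Complex.exp (Complex.I * (-γ : ℝ)) * (h ξ * B (L ξ - c)) =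
        ((σ * ψ ‖ξ‖ * B (L ξ - c) : ℝ) : ℂ) *
          Complex.exp ((t * ξ ⟨0, hd⟩ * ‖ξ‖ + inner ℝ x₀ ξ - γ : ℝ) * Complex.I) := by
      simp only [hh]
      rw [show ((t * ξ ⟨0, hd⟩ * ‖ξ‖ + inner ℝ x₀ ξ - γ : ℝ) : ℂ) * Complex.I =
        Complex.I * (-γ : ℝ) + Complex.I * (t * ξ ⟨0, hd⟩ * ‖ξ‖ + inner ℝ x₀ ξ : ℝ) by
          push_cast; ring, Complex.exp_add]
      push_cast; ring
    simp only [hF]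
    rw [e, Complex.re_ofReal_mul, Complex.exp_ofReal_mul_I_re]
    ring
  have cos_half : ∀ ξ, ‖L ξ - c‖ ≤ 1 →
      1 / 2 ≤ Real.cos (t * ξ ⟨0, hd⟩ * ‖ξ‖ + inner ℝ x₀ ξ - γ) := fun ξ hξ => by
    have h1 := (hloc ξ hξ).2
    have h2 := Real.one_sub_sq_div_two_le_cos (x := t * ξ ⟨0, hd⟩ * ‖ξ‖ + inner ℝ x₀ ξ - γ)
    have h3 : (t * ξ ⟨0, hd⟩ * ‖ξ‖ + inner ℝ x₀ ξ - γ) ^ 2 ≤ 1 := by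
      rw [← sq_abs]; exact pow_le_one₀ (abs_nonneg _) h1
    linarith
  have F0 : ∀ ξ, 0 ≤ F ξ := fun ξ => by
    rw [Feq]
    rcases le_or_gt ‖L ξ - c‖ 1 with h1 | h1
    · have := (hloc ξ h1).1
      have := cos_half ξ h1
      have := B0 (L ξ - c)
      have : 0 ≤ σ * ψ ‖ξ‖ := by linarith
      positivity
    · rw [Bs _ h1, mul_zero]
  have ihB : Integrable fun ξ => h ξ * B (L ξ - c) := by
    obtain ⟨C, hC⟩ : ∃ C, ∀ w, ‖(B w : ℂ)‖ ≤ C := by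
      obtain ⟨C, hC⟩ := (isCompact_closedBall (0 : EuclideanSpace ℝ (Fin d))
        1).exists_bound_of_continuousOn cB.continuousOn
      refine ⟨max C 0, fun w => ?_⟩
      rw [Complex.norm_real]
      rcases le_or_gt ‖w‖ 1 with h1 | h1
      · exact (hC w (by simpa using h1)).trans (le_max_left _ _)
      · rw [Bs _ h1, norm_zero]; exact le_max_right _ _
    exact ih.mul_bdd (c := C) (by fun_prop : Continuous _).aestronglyMeasurable
      (Filter.Eventually.of_forall fun ξ => hC _)
  have iF' := ihB.const_mul (σ * Complex.exp (Complex.I * (-γ : ℝ)))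
  have iF : Integrable F := iF'.re
  have Fle : ∫ ξ, F ξ ≤ ‖∫ ξ, h ξ * B (L ξ - c)‖ := by
    have e : ∫ ξ, F ξ = (∫ ξ, σ * Complex.exp (Complex.I * (-γ : ℝ)) * (h ξ * B (L ξ - c))).re :=
      integral_re iF'
    rw [e, integral_const_mul]
    refine (Complex.re_le_norm _).trans (le_of_eq ?_)
    rw [norm_mul, norm_mul, norm_exp_I_mul, Complex.norm_real, Real.norm_eq_abs, hσ, one_mul,
      one_mul]
  set S := L ⁻¹' Metric.closedBall c (1 / 2) with hS
  have mS : MeasurableSet S := cL.measurable Metric.isClosed_closedBall.measurableSet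
  have volS : volume S = ENNReal.ofReal |(LinearMap.det L)⁻¹| *
      volume (Metric.closedBall (0 : EuclideanSpace ℝ (Fin d)) (1 / 2)) := by
    rw [hS, Measure.addHaar_preimage_linearMap _ hL, Measure.addHaar_closedBall_center]
  have volS' : volume.real S = |LinearMap.det L|⁻¹ * v := by
    rw [measureReal_def, volS, ENNReal.toReal_mul, ENNReal.toReal_ofReal (abs_nonneg _), abs_inv]
    rfl
  have fin : volume S ≠ ⊤ := by
    rw [volS]
    exact ENNReal.mul_ne_top ENNReal.ofReal_ne_top measure_closedBall_lt_top.ne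
  have lower : a / 2 * volume.real S ≤ ∫ ξ, F ξ := by
    refine le_trans ?_ (setIntegral_le_integral iF (Filter.Eventually.of_forall F0) (s := S))
    refine setIntegral_ge_of_const_le_real mS fin (fun ξ hξ => ?_) iF.integrableOn
    have h1 : ‖L ξ - c‖ ≤ 1 / 2 := by
      rw [← dist_eq_norm]; exact hξ
    have h2 : ‖L ξ - c‖ ≤ 1 := h1.trans (by norm_num)
    rw [Feq, B1 _ h1, mul_one]
    have := (hloc ξ h2).1
    have := cos_half ξ h2
    nlinarith
  have := lower.trans (Fle.trans upper)
  rw [volS'] at this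
  have e : m * (κ + 1) = a / 2 * (|LinearMap.det L|⁻¹ * v) := by
    rw [hm]; field_simp
  linarith

theorem rateIsOptimal_of_pos {d : ℕ} {hd : 0 < d} {ψ : ℝ → ℝ} {α c T : ℝ} (hc : 0 < c) (hT : 0 < T)
    (h : ∀ t, T ≤ t → ∃ x, c * t ^ (-α) ≤ ‖oscIntegral hd ψ t x‖) : RateIsOptimal hd ψ α := by
  refine ⟨c, T, hc, hT, fun t ht => ?_⟩
  obtain ⟨x, hx⟩ := h _ ht
  rcases abs_cases t with ⟨e, _⟩ | ⟨e, _⟩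
  · exact ⟨x, by rwa [e] at hx ⊢⟩
  · rw [e] at hx ⊢
    exact ⟨-x, by rwa [oscIntegral_neg] at hx⟩

theorem exists_pos_le_near {ψ : ℝ → ℝ} (cψ : Continuous ψ)
    (hψ : ∀ r, r ∉ Icc (1 / 2 : ℝ) 2 → ψ r = 0) (h0 : ψ ≠ 0) :
    ∃ r₀ ∈ Icc (1 / 2 : ℝ) 2, ∃ a σ η : ℝ, 0 < a ∧ |σ| = 1 ∧ 0 < η ∧
      ∀ r, |r - r₀| < η → a ≤ σ * ψ r := by
  obtain ⟨r₀, hr₀⟩ := Function.ne_iff.1 h0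
  have hr₀' : ψ r₀ ≠ 0 := hr₀
  have mem : r₀ ∈ Icc (1 / 2 : ℝ) 2 := by
    by_contra h
    exact hr₀' (hψ r₀ h)
  obtain ⟨σ, hσ, e⟩ : ∃ σ : ℝ, |σ| = 1 ∧ σ * ψ r₀ = |ψ r₀| := by
    rcases abs_cases (ψ r₀) with ⟨e, _⟩ | ⟨e, _⟩
    · exact ⟨1, abs_one, by rw [e, one_mul]⟩
    · exact ⟨-1, by norm_num, by rw [e, neg_one_mul]⟩
  have hpos : |ψ r₀| / 2 < σ * ψ r₀ := by
    rw [e]; linarith [abs_pos.2 hr₀']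
  have ev := (continuous_const.mul cψ : Continuous fun r => σ * ψ r).continuousAt.eventually
    (lt_mem_nhds hpos)
  obtain ⟨η, hη, hh⟩ := Metric.eventually_nhds_iff.1 ev
  exact ⟨r₀, mem, |ψ r₀| / 2, σ, η, by positivity, hσ, hη, fun r hr => (hh hr).le⟩

/-- Near the hyperplane `ξ₁ = 0` the phase is negligible on a slab of width `1/t`. -/
theorem rateIsOptimal_one (n : ℕ) (hd : 0 < n + 2) {ψ : ℝ → ℝ} (cψ : Continuous ψ)
    (hψ : ∀ r, r ∉ Icc (1 / 2 : ℝ) 2 → ψ r = 0) (h0 : ψ ≠ 0) : RateIsOptimal hd ψ 1 := by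
  obtain ⟨r₀, hr₀, a, σ, η, ha, hσ, hη, hnear⟩ := exists_pos_le_near cψ hψ h0
  obtain ⟨c₁, hc₁, key⟩ := exists_le_norm_oscIntegral hd cψ hψ
  -- The bound ε < η keeps |ξ| where ψ has a fixed sign; ε ≤ 1/3 makes the phase at most (1/3)·3,
  -- since |ξ| ≤ 3 there.
  obtain ⟨ε, hε, hεη, hε3⟩ : ∃ ε : ℝ, 0 < ε ∧ ε < η ∧ ε ≤ 1 / 3 :=
    ⟨min (η / 2) (1 / 3), by positivity, (min_le_left _ _).trans_lt (by linarith),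
      min_le_right _ _⟩
  refine rateIsOptimal_of_pos (c := c₁ * a * ε ^ (n + 2)) (T := 1) (by positivity) one_pos
    fun t ht => ?_
  have t0 : 0 < t := by linarith
  set w : Fin (n + 2) → ℝ := Fin.cons (t / ε) fun _ => 1 / ε with hw
  have w0 : w 0 = t / ε := rfl
  have wle : ∀ i, 1 / ε ≤ w i := fun i => by
    refine Fin.cases ?_ (fun j => ?_) i
    · rw [w0]; gcongr
    · exact le_rfl
  set L : EuclideanSpace ℝ (Fin (n + 2)) →ₗ[ℝ] EuclideanSpace ℝ (Fin (n + 2)) :=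
    Matrix.toLpLin 2 2 (Matrix.diagonal w) with hL
  have Lapp : ∀ ξ i, L ξ i = w i * ξ i := fun ξ i => by
    rw [hL, Matrix.toLpLin_apply]
    exact Matrix.mulVec_diagonal w ξ.ofLp i
  have det : LinearMap.det L = t / ε ^ (n + 2) := by
    rw [hL, Matrix.toLpLin_eq_toLin, LinearMap.det_toLin, Matrix.det_diagonal, Fin.prod_univ_succ,
      w0]
    simp only [hw, Fin.cons_succ, Finset.prod_const, Finset.card_univ, Fintype.card_fin]
    rw [div_pow, one_pow, pow_succ ε (n + 1)]
    field_simp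
  set ξ₀ : EuclideanSpace ℝ (Fin (n + 2)) := EuclideanSpace.single 1 r₀ with hξ₀
  have nξ₀ : ‖ξ₀‖ = r₀ := by
    rw [hξ₀, PiLp.norm_single, Real.norm_of_nonneg (by linarith [hr₀.1])]
  refine Exists.imp (fun x hx => le_trans (le_of_eq ?_) hx)
    (key a t σ 0 L (L ξ₀) 0 ha hσ (by rw [det]; positivity) fun ξ hξ => ?_)
  · rw [det, abs_of_pos (by positivity), Real.rpow_neg_one]
    field_simp
  · rw [← map_sub] at hξ
    have coord : ∀ i, |L (ξ - ξ₀) i| ≤ 1 := fun i => (PiLp.norm_apply_le _ i).trans hξ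
    have hdist : ‖ξ - ξ₀‖ ≤ ε := by
      have h1 : ‖ξ - ξ₀‖ ≤ ε * ‖L (ξ - ξ₀)‖ := by
        rw [EuclideanSpace.norm_eq, EuclideanSpace.norm_eq, ← Real.sqrt_sq hε.le,
          ← Real.sqrt_mul (by positivity), Finset.mul_sum]
        refine Real.sqrt_le_sqrt (Finset.sum_le_sum fun i _ => ?_)
        rw [Lapp, norm_mul, ← mul_pow]
        have h2 : 1 ≤ ε * ‖w i‖ := by
          rw [Real.norm_of_nonneg ((by positivity : (0 : ℝ) ≤ 1 / ε).trans (wle i))]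
          calc (1 : ℝ) = ε * (1 / ε) := by field_simp
            _ ≤ _ := by gcongr; exact wle i
        refine pow_le_pow_left₀ (norm_nonneg _) ?_ 2
        rw [← mul_assoc]
        exact le_mul_of_one_le_left (norm_nonneg _) h2
      nlinarith
    have hn : |‖ξ‖ - r₀| ≤ ε := by
      rw [← nξ₀]; exact (abs_norm_sub_norm_le _ _).trans hdist
    refine ⟨hnear _ (hn.trans_lt hεη), ?_⟩
    have h3 : |t * ξ 0| ≤ ε := by
      have := coord 0
      have e0 : ξ₀ 0 = 0 := by simp [hξ₀]
      rw [Lapp, w0, PiLp.sub_apply, e0, sub_zero, div_mul_eq_mul_div, abs_div, abs_of_pos hε,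
        div_le_one hε] at this
      exact this
    rw [inner_zero_left, add_zero, sub_zero, abs_mul, abs_norm]
    have h4 : ‖ξ‖ ≤ 3 := by linarith [(abs_le.1 hn).2, hr₀.2]
    calc |t * ξ 0| * ‖ξ‖ ≤ 1 / 3 * 3 := by
          gcongr
          exact h3.trans hε3
      _ ≤ 1 := by norm_num

/-- Third-order behaviour of `ξ₁|ξ|` at a point where its planar Hessian degenerates. -/
theorem abs_fold_phase_sub_le {ρ a β : ℝ} (h1 : 1 / 4 ≤ ρ) (h2 : ρ ≤ 2) (ha : |a| ≤ 1 / 100)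
    (hβ : |β| ≤ 1 / 100) :
    |(ρ + a - β) * √((ρ + a - β) ^ 2 + 2 * (ρ + 2 * β) ^ 2) -
      (√3 * ρ ^ 2 + 4 / 3 * √3 * ρ * a)| ≤ 1300 * (a ^ 2 + |a| * β ^ 2 + |β| ^ 3) := by
  have s3 : √3 * √3 = 3 := Real.mul_self_sqrt (by norm_num)
  have s31 : 1.7 ≤ √3 := Real.le_sqrt_of_sq_le (by norm_num)
  have ha' := abs_le.1 ha
  have hβ' := abs_le.1 hβ
  obtain ⟨N, hN⟩ : ∃ N, N = (ρ + a - β) ^ 2 + 2 * (ρ + 2 * β) ^ 2 := ⟨_, rfl⟩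
  have hN0 : 0 ≤ N := by rw [hN]; positivity
  rw [← hN]
  have sN : √N * √N = N := Real.mul_self_sqrt hN0
  obtain ⟨φ, hφ⟩ : ∃ φ, φ = (ρ + a - β) * √N := ⟨_, rfl⟩
  obtain ⟨l, hl⟩ : ∃ l, l = √3 * ρ ^ 2 + 4 / 3 * √3 * ρ * a := ⟨_, rfl⟩
  rw [← hφ, ← hl]
  have φ0 : 0 ≤ φ := hφ ▸ mul_nonneg (by linarith) (Real.sqrt_nonneg _)
  have l0 : 1 / 10 ≤ l := by
    have e : l = √3 * (ρ * (ρ + 4 / 3 * a)) := by rw [hl]; ring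
    have : 1 / 4 * (1 / 4 - 4 / 300) ≤ ρ * (ρ + 4 / 3 * a) := by
      apply mul_le_mul h1 (by linarith) (by norm_num) (by linarith)
    rw [e]; nlinarith
  -- Comparing squares removes the root: φ² - l² is a polynomial with every term divisible by a²,
  -- aβ² or β³, and φ + l ≥ 1/10 turns the coefficient bound 130 into 1300.
  have diff : (φ - l) * (φ + l) =
      a ^ 2 * (6 * (ρ - β) ^ 2 + 2 * (ρ + 2 * β) ^ 2 + 4 * (ρ - β) * a + a ^ 2 - 16 / 3 * ρ ^ 2) +
      a * β ^ 2 * (12 * ρ - 20 * β) + β ^ 3 * (-12 * ρ + 9 * β) := by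
    have e1 : φ * φ = (ρ + a - β) ^ 2 * N := by
      rw [hφ]; linear_combination (ρ + a - β) ^ 2 * sN
    have e2 : l * l = 3 * (ρ ^ 2 + 4 / 3 * ρ * a) ^ 2 := by
      rw [hl]; linear_combination (ρ ^ 2 + 4 / 3 * ρ * a) ^ 2 * s3
    rw [show (φ - l) * (φ + l) = φ * φ - l * l by ring, e1, e2, hN]
    ring
  have b1 : |6 * (ρ - β) ^ 2 + 2 * (ρ + 2 * β) ^ 2 + 4 * (ρ - β) * a + a ^ 2 - 16 / 3 * ρ ^ 2| ≤
      130 := by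
    have u1 : (ρ - β) ^ 2 ≤ 3 ^ 2 := pow_le_pow_left₀ (by linarith) (by linarith) 2
    have u2 : (ρ + 2 * β) ^ 2 ≤ 3 ^ 2 := pow_le_pow_left₀ (by linarith) (by linarith) 2
    have u3 : ρ ^ 2 ≤ 2 ^ 2 := pow_le_pow_left₀ (by linarith) h2 2
    have u4 : a ^ 2 ≤ 1 := by rw [← sq_abs]; exact pow_le_one₀ (abs_nonneg _) (by linarith)
    have u5 : |(ρ - β) * a| ≤ 3 * (1 / 100) := by
      rw [abs_mul]
      exact mul_le_mul (abs_le.2 ⟨by linarith, by linarith⟩) ha (abs_nonneg _) (by norm_num)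
    have u6 := abs_le.1 u5
    rw [abs_le]
    constructor <;> linarith [sq_nonneg (ρ - β), sq_nonneg (ρ + 2 * β), sq_nonneg a, sq_nonneg ρ]
  have b2 : |12 * ρ - 20 * β| ≤ 130 := by rw [abs_le]; constructor <;> linarith
  have b3 : |-12 * ρ + 9 * β| ≤ 130 := by rw [abs_le]; constructor <;> linarith
  have b4 : |(φ - l) * (φ + l)| ≤ 130 * (a ^ 2 + |a| * β ^ 2 + |β| ^ 3) := by
    rw [diff]
    refine (abs_add_three _ _ _).trans ?_
    rw [abs_mul, abs_mul (a * β ^ 2), abs_mul a, abs_mul (β ^ 3), abs_pow β 3,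
      abs_of_nonneg (sq_nonneg a), abs_of_nonneg (sq_nonneg β)]
    have q1 := mul_le_mul_of_nonneg_left b1 (sq_nonneg a)
    have q2 := mul_le_mul_of_nonneg_left b2 (by positivity : 0 ≤ |a| * β ^ 2)
    have q3 := mul_le_mul_of_nonneg_left b3 (by positivity : 0 ≤ |β| ^ 3)
    linarith
  rw [abs_mul, abs_of_nonneg (by linarith : 0 ≤ φ + l)] at b4
  nlinarith [abs_nonneg (φ - l)]

theorem abs_radius_sub_le {ρ A β ε r₀ R : ℝ} (hr₀ : 1 / 2 ≤ r₀) (hρr : r₀ ^ 2 = 3 * ρ ^ 2)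
    (h1 : 0 ≤ ρ) (h2 : ρ ≤ 2) (hε : ε ≤ 1 / 100) (hA : |A| ≤ ε) (hβ : |β| ≤ ε) (hR : 0 ≤ R)
    (h : R ^ 2 = (ρ + A - β) ^ 2 + 2 * (ρ + 2 * β) ^ 2) : |R - r₀| ≤ 100 * ε := by
  have e : (R - r₀) * (R + r₀) =
      ρ * β * 6 + β * β * 9 + ρ * A * 2 + A * β * (-2) + A * A := by
    rw [show (R - r₀) * (R + r₀) = R ^ 2 - r₀ ^ 2 by ring, h, hρr]
    ring
  have hε0 : 0 ≤ ε := (abs_nonneg _).trans hA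
  have m1 : |ρ * β| ≤ 2 * ε := by
    rw [abs_mul, abs_of_nonneg h1]; exact mul_le_mul h2 hβ (abs_nonneg _) (by norm_num)
  have m2 : |ρ * A| ≤ 2 * ε := by
    rw [abs_mul, abs_of_nonneg h1]; exact mul_le_mul h2 hA (abs_nonneg _) (by norm_num)
  have m3 : ∀ x y : ℝ, |x| ≤ ε → |y| ≤ ε → |x * y| ≤ 1 * ε := fun x y hx hy => by
    rw [abs_mul]
    exact mul_le_mul (hx.trans (by linarith)) hy (abs_nonneg _) (by norm_num)
  have m1 := abs_le.1 m1
  have m2 := abs_le.1 m2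
  have m4 := abs_le.1 (m3 β β hβ hβ)
  have m5 := abs_le.1 (m3 A β hA hβ)
  have m6 := abs_le.1 (m3 A A hA hA)
  have e2 : |(R - r₀) * (R + r₀)| ≤ 50 * ε := by
    rw [e, abs_le]; constructor <;> linarith
  rw [abs_mul, abs_of_nonneg (by linarith : 0 ≤ R + r₀)] at e2
  have e3 := mul_le_mul_of_nonneg_left (by linarith : 1 / 2 ≤ R + r₀) (abs_nonneg (R - r₀))
  linarith

/-- The sides t^{-1/2} and t^{-1/3} are the largest for which tA² and t|β|³ stay bounded; the mixed
term is then smaller still. -/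
theorem mul_fold_error_le {t p q A β ε : ℝ} (hp : 0 < p) (hq : 0 < q) (p2 : p ^ 2 = t)
    (q3 : q ^ 3 = t) (tpq : t ≤ p * q ^ 2) (hε0 : 0 ≤ ε) (hε : ε ≤ 1 / 100) (cA : p * |A| ≤ ε)
    (cβ : q * |β| ≤ ε) :
    t * (1300 * (A ^ 2 + |A| * β ^ 2 + |β| ^ 3)) ≤ 1 := by
  have f1 : t * A ^ 2 ≤ ε ^ 2 := by
    rw [← p2, ← sq_abs A, ← mul_pow]
    exact pow_le_pow_left₀ (by positivity) cA 2
  have f3 : t * |β| ^ 3 ≤ ε ^ 3 := by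
    rw [← q3, ← mul_pow]
    exact pow_le_pow_left₀ (by positivity) cβ 3
  have f2 : t * (|A| * β ^ 2) ≤ ε ^ 3 := by
    calc t * (|A| * β ^ 2) ≤ p * q ^ 2 * (|A| * β ^ 2) := by gcongr
      _ = (p * |A|) * (q * |β|) ^ 2 := by rw [mul_pow, sq_abs]; ring
      _ ≤ ε * ε ^ 2 := by gcongr
      _ = ε ^ 3 := by ring
  have g2 : ε ^ 2 ≤ (1 / 100) ^ 2 := pow_le_pow_left₀ hε0 hε 2
  have g3 : ε ^ 3 ≤ (1 / 100) ^ 3 := pow_le_pow_left₀ hε0 hε 3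
  calc _ = 1300 * (t * A ^ 2 + t * (|A| * β ^ 2) + t * |β| ^ 3) := by ring
    _ ≤ 1 := by linarith

/-- In the plane, the phase is nearly linear on a `t^{-1/2} × t^{-1/3}` box around a point where
its Hessian degenerates. -/
theorem rateIsOptimal_plane {ψ : ℝ → ℝ} (cψ : Continuous ψ)
    (hψ : ∀ r, r ∉ Icc (1 / 2 : ℝ) 2 → ψ r = 0) (h0 : ψ ≠ 0) :
    RateIsOptimal (d := 2) two_pos ψ (5 / 6) := by
  obtain ⟨r₀, hr₀, a, σ, η, ha, hσ, hη, hnear⟩ := exists_pos_le_near cψ hψ h0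
  obtain ⟨c₁, hc₁, key⟩ := exists_le_norm_oscIntegral (d := 2) two_pos cψ hψ
  obtain ⟨ε, hε, hεη, hε3⟩ : ∃ ε : ℝ, 0 < ε ∧ 100 * ε < η ∧ ε ≤ 1 / 100 :=
    ⟨min (η / 200) (1 / 100), by positivity, by linarith [min_le_left (η / 200) (1 / 100)],
      min_le_right _ _⟩
  have s3 : √3 * √3 = 3 := Real.mul_self_sqrt (by norm_num)
  have s30 : 0 < √3 := by positivity
  have s31 : √3 ≤ 2 := Real.sqrt_le_iff.2 ⟨by norm_num, by norm_num⟩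
  have s32 : 1 ≤ √3 := Real.one_le_sqrt.2 (by norm_num)
  have s2 : √2 * √2 = 2 := Real.mul_self_sqrt (by norm_num)
  have s20 : 0 < √2 := by positivity
  -- The expansion point is (ρ, √2 ρ), of length √3 ρ = r₀; the Hessian of ξ₁|ξ| degenerates where
  -- ξ₂² = 2ξ₁².
  set ρ : ℝ := r₀ / √3 with hρ
  have hρr : √3 * ρ = r₀ := by rw [hρ]; field_simp
  have ρ1 : 1 / 4 ≤ ρ := by nlinarith [hr₀.1]
  have ρ2 : ρ ≤ 2 := by nlinarith [hr₀.2]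
  refine rateIsOptimal_of_pos (c := c₁ * a * (4 / √2 * ε ^ 2)) (T := 1) (by positivity) one_pos
    fun t ht => ?_
  have t0 : 0 < t := by linarith
  set p : ℝ := t ^ (1 / 2 : ℝ) with hp
  set q : ℝ := t ^ (1 / 3 : ℝ) with hq
  have p1 : 1 ≤ p := Real.one_le_rpow ht (by norm_num)
  have q1 : 1 ≤ q := Real.one_le_rpow ht (by norm_num)
  have p2 : p ^ 2 = t := by
    rw [hp, ← Real.rpow_natCast, ← Real.rpow_mul t0.le]; norm_num
  have q3 : q ^ 3 = t := by
    rw [hq, ← Real.rpow_natCast, ← Real.rpow_mul t0.le]; norm_num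
  have pq : p * q = t ^ (5 / 6 : ℝ) := by
    rw [hp, hq, ← Real.rpow_add t0]; norm_num
  have tpq : t ≤ p * q ^ 2 := by
    rw [pow_two, ← mul_assoc, pq, hq, ← Real.rpow_add t0]
    nth_rewrite 1 [← Real.rpow_one t]
    exact Real.rpow_le_rpow_of_exponent_le ht (by norm_num)
  -- The first row follows the gradient direction (1, √2/4) of ξ₁|ξ| at that point, at scale
  -- t^{-1/2}. A displacement β(-1, 2√2) along the kernel of the Hessian is invisible to it and is
  -- measured by the second row, at scale t^{-1/3}.
  set L : EuclideanSpace ℝ (Fin 2) →ₗ[ℝ] EuclideanSpace ℝ (Fin 2) :=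
    Matrix.toLpLin 2 2 !![p / ε, p / ε * (√2 / 4); 0, q / ε * (√2 / 4)] with hL
  have L0 : ∀ ξ, L ξ 0 = p / ε * (ξ 0 + √2 / 4 * ξ 1) := fun ξ => by
    rw [hL, Matrix.toLpLin_apply]
    simp [Matrix.mulVec, dotProduct, Fin.sum_univ_two]
    ring
  have L1 : ∀ ξ, L ξ 1 = q / ε * (√2 / 4 * ξ 1) := fun ξ => by
    rw [hL, Matrix.toLpLin_apply]
    simp [Matrix.mulVec, dotProduct, Fin.sum_univ_two]
    ring
  have det : LinearMap.det L = p * q * (√2 / 4) / ε ^ 2 := by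
    rw [hL, Matrix.toLpLin_eq_toLin, LinearMap.det_toLin, Matrix.det_fin_two_of]
    field_simp
    ring
  -- The centre is the image under L of the expansion point; x₀ cancels the linear part of the phase
  -- and γ is the constant that remains.
  refine Exists.imp (fun x hx => le_trans (le_of_eq ?_) hx) (key a t σ (t * (√3 * ρ ^ 2 - 4 / 3 * √3 * ρ * (3 / 2 * ρ))) L
    !₂[p / ε * (3 / 2 * ρ), q / ε * (ρ / 2)]
    !₂[-(t * (4 / 3 * √3 * ρ)), -(t * (4 / 3 * √3 * ρ) * (√2 / 4))] ha hσ
    (by rw [det]; positivity) fun ξ hξ => ?_)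
  · rw [det, pq, abs_of_pos (by positivity), Real.rpow_neg t0.le]
    field_simp
  · obtain ⟨A, hA⟩ : ∃ A, A = ξ 0 + √2 / 4 * ξ 1 - 3 / 2 * ρ := ⟨_, rfl⟩
    obtain ⟨β, hβ⟩ : ∃ β, β = √2 / 4 * ξ 1 - ρ / 2 := ⟨_, rfl⟩
    have x0 : ξ 0 = ρ + A - β := by rw [hA, hβ]; ring
    have x1 : ξ 1 = √2 * (ρ + 2 * β) := by
      rw [hβ]; linear_combination (-1 / 2 * ξ 1) * s2
    have cA : p * |A| ≤ ε := by
      have h := (PiLp.norm_apply_le _ 0).trans hξ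
      rw [PiLp.sub_apply, L0] at h
      have e : p / ε * (ξ 0 + √2 / 4 * ξ 1) - (!₂[p / ε * (3 / 2 * ρ), q / ε * (ρ / 2)] :
          EuclideanSpace ℝ (Fin 2)) 0 = p * A / ε := by
        simp only [Matrix.cons_val_zero]
        rw [hA]; ring
      rw [e, Real.norm_eq_abs, abs_div, abs_mul, abs_of_pos hε, abs_of_pos (by linarith : 0 < p),
        div_le_one hε] at h
      exact h
    have cβ : q * |β| ≤ ε := by
      have h := (PiLp.norm_apply_le _ 1).trans hξ
      rw [PiLp.sub_apply, L1] at h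
      have e : q / ε * (√2 / 4 * ξ 1) - (!₂[p / ε * (3 / 2 * ρ), q / ε * (ρ / 2)] :
          EuclideanSpace ℝ (Fin 2)) 1 = q * β / ε := by
        simp only [Matrix.cons_val_one]
        rw [hβ]; simp; ring
      rw [e, Real.norm_eq_abs, abs_div, abs_mul, abs_of_pos hε, abs_of_pos (by linarith : 0 < q),
        div_le_one hε] at h
      exact h
    have bA : |A| ≤ ε := by nlinarith [abs_nonneg A]
    have bβ : |β| ≤ ε := by nlinarith [abs_nonneg β]
    have nsq : ‖ξ‖ = √((ρ + A - β) ^ 2 + 2 * (ρ + 2 * β) ^ 2) := by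
      rw [EuclideanSpace.norm_eq, Fin.sum_univ_two, Real.norm_eq_abs, Real.norm_eq_abs, sq_abs,
        sq_abs, x0, x1]
      congr 1
      linear_combination (ρ + 2 * β) ^ 2 * s2
    have nsq' : ‖ξ‖ ^ 2 = (ρ + A - β) ^ 2 + 2 * (ρ + 2 * β) ^ 2 := by
      rw [nsq, Real.sq_sqrt (by positivity)]
    constructor
    · exact hnear _ (lt_of_le_of_lt (abs_radius_sub_le hr₀.1
        (by rw [← hρr]; linear_combination ρ ^ 2 * s3) (by linarith) ρ2 hε3 bA bβ
        (norm_nonneg _) nsq') hεη)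
    · have fold := abs_fold_phase_sub_le ρ1 ρ2 (bA.trans hε3) (bβ.trans hε3)
      rw [← nsq, ← x0] at fold
      have inn : inner ℝ (!₂[-(t * (4 / 3 * √3 * ρ)), -(t * (4 / 3 * √3 * ρ) * (√2 / 4))] :
          EuclideanSpace ℝ (Fin 2)) ξ = -(t * (4 / 3 * √3 * ρ)) * (A + 3 / 2 * ρ) := by
        rw [PiLp.inner_apply, Fin.sum_univ_two, hA]
        simp
        ring
      rw [inn]
      have e : t * ξ 0 * ‖ξ‖ + -(t * (4 / 3 * √3 * ρ)) * (A + 3 / 2 * ρ) -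
          t * (√3 * ρ ^ 2 - 4 / 3 * √3 * ρ * (3 / 2 * ρ)) =
          t * (ξ 0 * ‖ξ‖ - (√3 * ρ ^ 2 + 4 / 3 * √3 * ρ * A)) := by ring
      change |t * ξ 0 * ‖ξ‖ + _ - _| ≤ 1
      rw [e, abs_mul, abs_of_pos t0]
      exact (mul_le_mul_of_nonneg_left fold t0.le).trans (mul_fold_error_le (by linarith)
        (by linarith) p2 q3 tpq hε.le hε3 cA cβ)

end

/-! ### Assembly of the two dimension ranges -/

theorem proposition3p1 :
    (∀ (d : ℕ) (hd : 3 ≤ d) (ψ : SchwartzMap ℝ ℝ), tsupport ψ ⊆ Set.Icc (1 / 2) 2 →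
      DecaysAtRate (lt_of_lt_of_le (by norm_num) hd : 0 < d) ψ 1 ∧
        (ψ ≠ 0 → RateIsOptimal (lt_of_lt_of_le (by norm_num) hd : 0 < d) ψ 1)) ∧
    (∀ ψ : SchwartzMap ℝ ℝ, tsupport ψ ⊆ Set.Icc (1 / 2) 2 →
      DecaysAtRate (d := 2) two_pos ψ (5 / 6) ∧
        (ψ ≠ 0 → RateIsOptimal (d := 2) two_pos ψ (5 / 6))) := by
  have coe_ne : ∀ ψ : SchwartzMap ℝ ℝ, ψ ≠ 0 → (ψ : ℝ → ℝ) ≠ 0 := fun ψ h h' =>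
    h (DFunLike.coe_injective (h'.trans FunLike.coe_zero.symm))
  refine ⟨fun d hd ψ hψ => ?_, fun ψ hψ => ⟨decaysAtRate_of_le 0 _ ψ hψ (Or.inr rfl), fun h =>
    rateIsOptimal_plane ψ.continuous (eq_zero_of_notMem_of_tsupport_subset hψ) (coe_ne ψ h)⟩⟩
  -- Here d = (n + 1) + 2, so the sphere index n + 1 is at least 1, as the 1/ρ decay of the
  -- amplitude requires.
  obtain ⟨n, rfl⟩ := Nat.exists_eq_add_of_le' hd
  exact ⟨decaysAtRate_of_le (n + 1) _ ψ hψ (Or.inl ⟨by omega, rfl⟩), fun h =>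
    rateIsOptimal_one (n + 1) _ ψ.continuous (eq_zero_of_notMem_of_tsupport_subset hψ) (coe_ne ψ h)⟩
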